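/- Let $T>0$, $L>0$, and let $\mathbb T^3=(\mathbb R/L\mathbb Z)^3$. Let $1<p,q,m,n<\infty$ satisfy $$\frac2p+\frac1m=1,\qquad \frac2q+\frac1n=1,$$ and let $\theta:(0,T)\times\mathbb T^3\to\mathbb R$ and $v:(0,T)\times\mathbb T^3\to\mathbb R^3$ satisfy $$\theta\in L^\infty(0,T;L^2(\mathbb T^3))\cap L^p(0,T;L^q(\mathbb T^3)),\qquad v\in L^m(0,T;L^n(\mathbb T^3)).$$ Assume that $(v,\theta)$ is a weak solution of $\theta_t+v\cdot\nabla\theta=0$, $\operatorname{div}v=0$, that is, $\partial_t\theta+\operatorname{div}(\theta v)=0$ and $\operatorname{div}v=0$ in the sense of distributions on $(0,T)\times\mathbb T^3$. For $\ell\in\mathbb R^3$ write $\delta f(\ell)(t,x)=f(t,x+\ell)-f(t,x)$. For a mollifier $\varphi$ (that is, $\varphi\in C_c^\infty(\mathbb R^3)$, $\varphi\ge0$, $\int_{\mathbb R^3}\varphi=1$) put $\varphi_\varepsilon(\ell)=\varepsilon^{-3}\varphi(\ell/\varepsilon)$ and $$D_\varepsilon(v,\theta)=-\frac14\int_{\mathbb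 R^3}\nabla\varphi_\varepsilon(\ell)\cdot\delta v(\ell)\,|\delta\theta(\ell)|^2\,d\ell,\qquad \varepsilon>0,$$ and, with $\sigma$ the surface measure on the unit sphere $\partial B=\{\zeta\in\mathbb R^3:|\zeta|=1\}$, put $$S(v,\theta,\theta;\lambda)=\frac1\lambda\int_{\partial B}\zeta\cdot\delta v(\lambda\zeta)\,|\delta\theta(\lambda\zeta)|^2\,\frac{d\sigma(\zeta)}{4\pi},\qquad\lambda>0.$$ For each $\varepsilon,\lambda>0$ these integrals converge absolutely for almost every $(t,x)\in(0,T)\times\mathbb T^3$ and define functions in $L^1_{\mathrm{loc}}((0,T)\times\mathbb T^3)$. Moreover, there are distributions $D$ and $S$ on $(0,T)\times\mathbb T^3$ such that: 1. for every mollifier $\varphi$, $D_\varepsilon(v,\theta)\to D$ in the sense of distributions as $\varepsilon\to0^+$ (in particular $D$ does not depend on $\varphi$); 2. $\theta^2$ and $\theta^2v$ are locally integrable and $\partial_t\big(\tfrac12\theta^2\big)+\operatorname{div}\big(\tfrac12 v\,\theta^2\big)=D$ in the sense of distributions; 3. $-S(v,\theta,\theta;\lambda)\to S$ in the sense of distributions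 as $\lambda\to0^+$, and the $4/3$ law $S=-\tfrac43D$ holds. -/

import Mathlib

open MeasureTheory Filter Set
open scoped ContDiff Topology ENNReal

noncomputable section

namespace Yaglom

/-- Euclidean space `ℝ³`: values of the velocity, and increments `ℓ`. -/
abbrev E3 : Type := EuclideanSpace ℝ (Fin 3)

/-- The flat torus `𝕋³ = (ℝ / Lℤ)³`; its `volume` is Lebesgue measure, of total mass `L³`. -/
abbrev Torus (L : ℝ) : Type := Fin 3 → AddCircle L

variable {L : ℝ}

/-- The projection `ℝ³ → 𝕋³`. -/
def proj (L : ℝ) (l : E3) : Torus L := fun i => ((l i : ℝ) : AddCircle L)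

/-- The open space-time cylinder `(0,T) × 𝕋³`. -/
def slab (L T : ℝ) : Set (ℝ × Torus L) := Ioo 0 T ×ˢ univ

/-- The Bochner class `L^p(0,T; L^q(𝕋³))`, for functions of `(t,x)`: `f` is measurable,
`f(t,·) ∈ L^q` for almost every `t`, and `t ↦ ‖f(t,·)‖_{L^q}` belongs to `L^p(0,T)`. -/
structure MemLpLq [Fact (0 < L)] {F : Type*} [NormedAddCommGroup F] (T : ℝ) (p q : ℝ≥0∞)
    (f : ℝ × Torus L → F) : Prop where
  aestronglyMeasurable : AEStronglyMeasurable f (volume.restrict (slab L T))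
  ae_memLp : ∀ᵐ t ∂(volume.restrict (Ioo 0 T)), MemLp (fun x => f (t, x)) q volume
  memLp_norm : MemLp (fun t => (eLpNorm (fun x => f (t, x)) q volume).toReal) p
    (volume.restrict (Ioo 0 T))

/-- The lift to `ℝ × ℝ³` of a function on `ℝ × 𝕋³` (periodic in space). -/
def lift (ψ : ℝ × Torus L → ℝ) : ℝ × E3 → ℝ := fun z => ψ (z.1, proj L z.2)

/-- The space `C_c^∞((0,T) × 𝕋³)` of real test functions. (As `𝕋³` is compact, compact support
means that `ψ` vanishes for `t` outside a compact subinterval of `(0,T)`.) -/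
def TestFn (L T : ℝ) : Submodule ℝ (ℝ × Torus L → ℝ) where
  carrier := {ψ | ContDiff ℝ ∞ (lift ψ) ∧
    ∃ a b : ℝ, 0 < a ∧ b < T ∧ ∀ t x, t ∉ Icc a b → ψ (t, x) = 0}
  zero_mem' := ⟨contDiff_const, 1, T - 1, one_pos, by linarith, fun _ _ _ => rfl⟩
  add_mem' := by
    rintro ψ χ ⟨h1, a, b, ha, hb, h2⟩ ⟨k1, c, d, hc, hd, k2⟩
    refine ⟨h1.add k1, min a c, max b d, lt_min ha hc, max_lt hb hd, fun t x ht => ?_⟩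
    have e1 : ψ (t, x) = 0 :=
      h2 t x fun h => ht ⟨(min_le_left _ _).trans h.1, h.2.trans (le_max_left _ _)⟩
    have e2 : χ (t, x) = 0 :=
      k2 t x fun h => ht ⟨(min_le_right _ _).trans h.1, h.2.trans (le_max_right _ _)⟩
    simp [e1, e2]
  smul_mem' := by
    rintro c ψ ⟨h1, a, b, ha, hb, h2⟩
    exact ⟨contDiff_const.smul h1, a, b, ha, hb, fun t x ht => by simp [h2 t x ht]⟩

/-- The time derivative `∂_t ψ`. -/
def dt (ψ : ℝ × Torus L → ℝ) (z : ℝ × Torus L) : ℝ := deriv (fun s => ψ (s, z.2)) z.1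

/-- The spatial gradient `∇_x ψ`. -/
def gradx (ψ : ℝ × Torus L → ℝ) (z : ℝ × Torus L) : E3 :=
  gradient (fun l : E3 => ψ (z.1, z.2 + proj L l)) 0

/-- A linear functional on test functions is a distribution on `(0,T) × 𝕋³` if on the test
functions supported in each `[a,b] × 𝕋³`, `0 < a`, `b < T`, it is bounded by a multiple of the
supremum of finitely many derivatives. -/
def IsDistribution {T : ℝ} (D : TestFn L T →ₗ[ℝ] ℝ) : Prop :=
  ∀ a b : ℝ, 0 < a → b < T → ∃ (N : ℕ) (C : ℝ), ∀ ψ : TestFn L T,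
    (∀ t x, t ∉ Icc a b → (ψ : ℝ × Torus L → ℝ) (t, x) = 0) →
    ∀ M : ℝ, (∀ k ≤ N, ∀ z, ‖iteratedFDeriv ℝ k (lift (ψ : ℝ × Torus L → ℝ)) z‖ ≤ M) →
      |D ψ| ≤ C * M

/-- `f ∈ L¹_loc((0,T) × 𝕋³)`. -/
def LocL1 [Fact (0 < L)] {F : Type*} [NormedAddCommGroup F] (T : ℝ) (f : ℝ × Torus L → F) :
    Prop :=
  LocallyIntegrableOn f (slab L T) volume

/-- As `s ↓ 0`, the locally integrable functions `f s` (`s > 0`) converge to `D` in the sense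
of distributions on `(0,T) × 𝕋³`. -/
def TendstoDistrib [Fact (0 < L)] {T : ℝ} (f : ℝ → ℝ × Torus L → ℝ)
    (D : TestFn L T →ₗ[ℝ] ℝ) : Prop :=
  (∀ s > 0, LocL1 T (f s)) ∧
  ∀ ψ : TestFn L T,
    Tendsto (fun s => ∫ z in slab L T, f s z * (ψ : ℝ × Torus L → ℝ) z) (𝓝[>] 0) (𝓝 (D ψ))

/-- `(v, θ)` is a weak (distributional) solution on `(0,T) × 𝕋³` of
`θ_t + v·∇θ = 0`, `div v = 0`, where `v·∇θ = div (θ v)`. -/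
structure IsWeakSolution [Fact (0 < L)] (T : ℝ) (v : ℝ × Torus L → E3) (θ : ℝ × Torus L → ℝ) :
    Prop where
  locL1_scalar : LocL1 T θ
  locL1_velocity : LocL1 T v
  locL1_flux : LocL1 T (fun z => θ z • v z)
  transport : ∀ ψ ∈ TestFn L T,
    ∫ z in slab L T, (θ z * dt ψ z + inner ℝ (θ z • v z) (gradx ψ z)) = 0
  div_free : ∀ ψ ∈ TestFn L T, ∫ z in slab L T, inner ℝ (v z) (gradx ψ z) = 0

/-- The local balance `∂_t (θ²/2) + div (v θ²/2) = D` in the sense of distributions. -/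
def LocalEnergyBalance [Fact (0 < L)] {T : ℝ} (v : ℝ × Torus L → E3) (θ : ℝ × Torus L → ℝ)
    (D : TestFn L T →ₗ[ℝ] ℝ) : Prop :=
  LocL1 T (fun z => θ z ^ 2 / 2) ∧ LocL1 T (fun z => (θ z ^ 2 / 2) • v z) ∧
  ∀ ψ : TestFn L T,
    -∫ z in slab L T, (θ z ^ 2 / 2 * dt (ψ : ℝ × Torus L → ℝ) z
      + inner ℝ ((θ z ^ 2 / 2) • v z) (gradx (ψ : ℝ × Torus L → ℝ) z)) = D ψ

/-- The increment `δf(ℓ)(t,x) = f(t, x + ℓ) - f(t, x)`. -/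
def incr {F : Type*} [Sub F] (f : ℝ × Torus L → F) (l : E3) (z : ℝ × Torus L) : F :=
  f (z.1, z.2 + proj L l) - f z

/-- Mollifiers: smooth, nonnegative, compactly supported, of unit integral. -/
structure IsMollifier (φ : E3 → ℝ) : Prop where
  smooth : ContDiff ℝ ∞ φ
  compact_support : HasCompactSupport φ
  nonneg : ∀ l, 0 ≤ φ l
  integral_eq_one : ∫ l, φ l = 1

/-- `φ_ε(ℓ) = ε⁻³ φ(ℓ/ε)`. -/
def rescale (φ : E3 → ℝ) (ε : ℝ) (l : E3) : ℝ := (ε ^ 3)⁻¹ * φ (ε⁻¹ • l)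

/-- The integrand `∇φ_ε(ℓ) · δv(ℓ) |δθ(ℓ)|²`. -/
def drIntegrand (φ : E3 → ℝ) (v : ℝ × Torus L → E3) (θ : ℝ × Torus L → ℝ) (ε : ℝ)
    (z : ℝ × Torus L) (l : E3) : ℝ :=
  inner ℝ (gradient (rescale φ ε) l) (incr v l z) * |incr θ l z| ^ 2

/-- The Duchon–Robert term `D_ε(v,θ)(t,x) = -¼ ∫ ∇φ_ε(ℓ) · δv(ℓ) |δθ(ℓ)|² dℓ`.
Once `ε` is so small that `φ_ε` lives in a fundamental cell, the integral over `ℝ³` is the one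
over `𝕋³`. -/
def duchonRobert (φ : E3 → ℝ) (v : ℝ × Torus L → E3) (θ : ℝ × Torus L → ℝ) (ε : ℝ)
    (z : ℝ × Torus L) : ℝ :=
  -(1 / 4) * ∫ l : E3, drIntegrand φ v θ ε z l

/-- Surface measure `dσ` on the unit sphere of `ℝ³`, of total mass `4π`. -/
def surfaceMeasure : Measure (Metric.sphere (0 : E3) 1) := (volume : Measure E3).toSphere

/-- The integrand `ζ · δv(rζ) |δθ(rζ)|²`, for `ζ` on the unit sphere. -/
def sphereIntegrand (v : ℝ × Torus L → E3) (θ : ℝ × Torus L → ℝ) (r : ℝ)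
    (z : ℝ × Torus L) (ζ : Metric.sphere (0 : E3) 1) : ℝ :=
  inner ℝ (ζ : E3) (incr v (r • (ζ : E3)) z) * |incr θ (r • (ζ : E3)) z| ^ 2

/-- The structure function `S(v,θ,θ;r)(t,x) = (1/r) ∫_{|ζ|=1} ζ·δv(rζ) |δθ(rζ)|² dσ(ζ)/(4π)`. -/
def structureFn (v : ℝ × Torus L → E3) (θ : ℝ × Torus L → ℝ) (r : ℝ) (z : ℝ × Torus L) : ℝ :=
  1 / r * ((1 / (4 * Real.pi)) * ∫ ζ, sphereIntegrand v θ r z ζ ∂surfaceMeasure)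

end Yaglom

end

open Yaglom

/-!
For a test function `ψ` consider the third-order structure function
`F(h) = ∫ ψ(z) (v(z + h) - v(z)) (θ(z + h) - θ(z))² dz`, a vector field in the increment `h`
(`flux`). Expanding the product and using the two equations at the base point `z` and at the shifted
point `z + h`, all derivatives that fall on `v` or `θ` can be moved to `ψ`, and one finds
`div_h F = G` for an explicit `G` (`fluxDiv`) that contains only derivatives of `ψ`. The time
derivatives produced by the transport equation at the two points cancel. Moreover
`G(0) = 4 ⟨D, ψ⟩`, where `D = ∂ₜ(θ²/2) + div(v θ²/2)` (`fluxDiv_zero`).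

Both `F` and `G` are sums of trilinear correlations. The exponents are exactly those for which
Hölder's inequality bounds such correlations in the mixed norms, and since they are finite,
approximation by bounded functions shows that `F` and `G` are continuous (`continuous_tri`). In this
way the limits become elementary facts about a continuous field on `ℝ³` with a continuous
distributional divergence:

* `∫ ∇φ_ε · F = -∫ φ_ε G → -G(0)` for every mollifier (`tendsto_integral_fderiv_rescale`), which is
  `-¼ ∫ ∇φ_ε · F → ⟨D, ψ⟩`;
* by the divergence theorem on the ball of radius `r`, `(4π r)⁻¹ ∫ ζ · F(rζ) dσ(ζ)` is `1/3` times
  the mean of `G` over that ball, hence tends to `G(0) / 3 = (4/3) ⟨D, ψ⟩` (`tendsto_sphereFlux`).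

A weak solution has no equation on single time slices. The identity `div_h F = G` is therefore first
proved for increments in `ℝ × 𝕋³`, weakly against smooth kernels that are narrow in time
(`sum_integral_pd_mul_flux`); continuity then allows the kernels to be concentrated on purely
spatial increments (`sum_integral_fderiv_mul_of_kernel`). The kernels are normalized powers of an
explicit function on `ℝ × 𝕋³` with a unique maximum.
-/

namespace Yaglom

noncomputable section

section

variable {L : ℝ}

/-! ### Truncation and mixed Lebesgue norms -/

/-- The truncation of `f` at height `N`: the values above `N` are replaced by `0`. -/
def trunc (N : ℕ) (f : ℝ × Torus L → ℝ) (z : ℝ × Torus L) : ℝ :=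
  if ‖f z‖ ≤ N then f z else 0

theorem norm_trunc_le (N : ℕ) (f : ℝ × Torus L → ℝ) (z) : ‖trunc N f z‖ ≤ N := by
  unfold trunc
  split_ifs with h
  exacts [h, by simp]

theorem enorm_trunc_le (N : ℕ) (f : ℝ × Torus L → ℝ) (z) : ‖trunc N f z‖ₑ ≤ ‖f z‖ₑ := by
  unfold trunc
  split_ifs with h
  exacts [le_rfl, by simp]

theorem enorm_sub_trunc_le (N : ℕ) (f : ℝ × Torus L → ℝ) (z) :
    ‖f z - trunc N f z‖ₑ ≤ ‖f z‖ₑ := by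
  unfold trunc
  split_ifs with h <;> simp

theorem tendsto_sub_trunc (f : ℝ × Torus L → ℝ) (z) :
    Tendsto (fun N => ‖f z - trunc N f z‖ₑ) atTop (𝓝 0) := by
  apply tendsto_const_nhds.congr'
  filter_upwards [eventually_ge_atTop ⌈‖f z‖⌉₊] with N hN
  have : ‖f z‖ ≤ N := Nat.ceil_le.1 hN
  rw [trunc, if_pos this, sub_self, enorm_zero]

variable [Fact (0 < L)]

instance isAddHaarMeasure_volume : (volume : Measure (ℝ × Torus L)).IsAddHaarMeasure :=
  Measure.prod.instIsAddHaarMeasure (volume : Measure ℝ) (volume : Measure (Torus L))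

instance isFiniteMeasure_surfaceMeasure : IsFiniteMeasure surfaceMeasure := by
  unfold surfaceMeasure; infer_instance

/-- Hölder's inequality for three factors, two of which carry the same exponent. -/
theorem lintegral_mul_mul_le_Lp {α : Type*} [MeasurableSpace α] {μ : Measure α} {p m : ℝ}
    (hp : 0 < p) (hm : 0 < m) (hpm : 2 / p + 1 / m = 1) {f g k : α → ℝ≥0∞}
    (hf : AEMeasurable f μ) (hg : AEMeasurable g μ) (hk : AEMeasurable k μ) :
    ∫⁻ x, f x * g x * k x ∂μ ≤
      (∫⁻ x, f x ^ p ∂μ) ^ (1 / p) * (∫⁻ x, g x ^ p ∂μ) ^ (1 / p)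
        * (∫⁻ x, k x ^ m ∂μ) ^ (1 / m) := by
  have key := ENNReal.lintegral_prod_norm_pow_le (μ := μ) (Finset.univ : Finset (Fin 3))
    (f := ![fun x => f x ^ p, fun x => g x ^ p, fun x => k x ^ m])
    (p := ![1 / p, 1 / p, 1 / m]) (by
      intro i _
      fin_cases i
      exacts [hf.pow_const p, hg.pow_const p, hk.pow_const m])
    (by simp [Fin.sum_univ_three]; rw [← hpm]; ring)
    (by
      intro i _
      fin_cases i <;> simp <;> positivity)
  simpa [Fin.prod_univ_three, ← ENNReal.rpow_mul, hp.ne', hm.ne'] using key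

/-- The norm of `L^p(ℝ; L^q(𝕋³))`, for finite exponents. -/
def mixedNorm (p q : ℝ) (f : ℝ × Torus L → ℝ) : ℝ≥0∞ :=
  (∫⁻ t, ((∫⁻ x, ‖f (t, x)‖ₑ ^ q) ^ (1 / q)) ^ p) ^ (1 / p)

/-- Membership in `L^p(ℝ; L^q(𝕋³))`, for finite exponents. -/
structure MemMixed (p q : ℝ) (f : ℝ × Torus L → ℝ) : Prop where
  aestronglyMeasurable : AEStronglyMeasurable f volume
  mixedNorm_lt_top : mixedNorm p q f < ⊤

theorem mixedNorm_comp_add (p q : ℝ) (f : ℝ × Torus L → ℝ) (h : ℝ × Torus L) :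
    mixedNorm p q (fun z => f (z + h)) = mixedNorm p q f := by
  unfold mixedNorm
  congr 1
  have : ∀ t, (∫⁻ x, ‖f ((t, x) + h)‖ₑ ^ q) = ∫⁻ x, ‖f (t + h.1, x)‖ₑ ^ q := fun t =>
    lintegral_add_right_eq_self (μ := (volume : Measure (Torus L)))
      (fun x => ‖f (t + h.1, x)‖ₑ ^ q) h.2
  simp_rw [this]
  exact lintegral_add_right_eq_self (μ := (volume : Measure ℝ))
      (fun t => ((∫⁻ x, ‖f (t, x)‖ₑ ^ q) ^ (1 / q)) ^ p) h.1

theorem mixedNorm_mono {p q : ℝ} (hp : 0 < p) (hq : 0 < q) {f g : ℝ × Torus L → ℝ}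
    (h : ∀ z, ‖f z‖ₑ ≤ ‖g z‖ₑ) : mixedNorm p q f ≤ mixedNorm p q g := by
  unfold mixedNorm
  gcongr with t x
  exact h _

theorem aemeasurable_slice {f : ℝ × Torus L → ℝ} (hf : AEStronglyMeasurable f volume) :
    ∀ᵐ t : ℝ, AEMeasurable (fun x => f (t, x)) volume := by
  have h : AEStronglyMeasurable f ((volume : Measure ℝ).prod (volume : Measure (Torus L))) := hf
  exact h.prodMk_left.mono fun t ht => ht.aemeasurable

theorem aemeasurable_lintegral_slice {f : ℝ × Torus L → ℝ} (hf : AEStronglyMeasurable f volume)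
    (q : ℝ) : AEMeasurable (fun t : ℝ => ∫⁻ x, ‖f (t, x)‖ₑ ^ q) volume := by
  have h : AEMeasurable (fun z => ‖f z‖ₑ ^ q)
    ((volume : Measure ℝ).prod (volume : Measure (Torus L))) := hf.enorm.pow_const q
  exact h.lintegral_prod_right'

/-- The exponent relations under which `‖a b c‖_{L¹} ≤ ‖a‖ ‖b‖ ‖c‖`, for `a, b` in
`L^p(ℝ; L^q)` and `c` in `L^m(ℝ; L^n)`. -/
structure HolderExponents (p q m n : ℝ) : Prop where
  hp : 0 < p
  hq : 0 < q
  hm : 0 < m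
  hn : 0 < n
  hpm : 2 / p + 1 / m = 1
  hqn : 2 / q + 1 / n = 1

/-- Hölder's inequality in the mixed norms. -/
theorem lintegral_mul_mul_le_mixedNorm {p q m n : ℝ} (e : HolderExponents p q m n)
    {a b c : ℝ × Torus L → ℝ}
    (ha : AEStronglyMeasurable a volume) (hb : AEStronglyMeasurable b volume)
    (hc : AEStronglyMeasurable c volume) :
    ∫⁻ z, ‖a z‖ₑ * ‖b z‖ₑ * ‖c z‖ₑ ≤ mixedNorm p q a * mixedNorm p q b * mixedNorm m n c := by
  have h1 : ∫⁻ z, ‖a z‖ₑ * ‖b z‖ₑ * ‖c z‖ₑ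
      = ∫⁻ t, ∫⁻ x, ‖a (t, x)‖ₑ * ‖b (t, x)‖ₑ * ‖c (t, x)‖ₑ :=
    lintegral_prod (μ := (volume : Measure ℝ)) (ν := (volume : Measure (Torus L)))
      (fun z => ‖a z‖ₑ * ‖b z‖ₑ * ‖c z‖ₑ) ((ha.enorm.mul hb.enorm).mul hc.enorm)
  rw [h1]
  calc _ ≤ ∫⁻ t, (∫⁻ x, ‖a (t, x)‖ₑ ^ q) ^ (1 / q) * (∫⁻ x, ‖b (t, x)‖ₑ ^ q) ^ (1 / q)
        * (∫⁻ x, ‖c (t, x)‖ₑ ^ n) ^ (1 / n) := by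
        apply lintegral_mono_ae
        filter_upwards [aemeasurable_slice ha, aemeasurable_slice hb, aemeasurable_slice hc]
          with t hta htb htc
        exact lintegral_mul_mul_le_Lp e.hq e.hn e.hqn hta.enorm htb.enorm htc.enorm
    _ ≤ _ := lintegral_mul_mul_le_Lp e.hp e.hm e.hpm
        ((aemeasurable_lintegral_slice ha q).pow_const _)
        ((aemeasurable_lintegral_slice hb q).pow_const _)
        ((aemeasurable_lintegral_slice hc n).pow_const _)

theorem aestronglyMeasurable_trunc (N : ℕ) {f : ℝ × Torus L → ℝ}
    (hf : AEStronglyMeasurable f volume) : AEStronglyMeasurable (trunc N f) volume := by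
  have : trunc N f = (fun y : ℝ => if ‖y‖ ≤ N then y else 0) ∘ f := rfl
  rw [this]
  have hm : Measurable (fun y : ℝ => if ‖y‖ ≤ N then y else 0) :=
    Measurable.ite (measurableSet_le measurable_norm measurable_const) measurable_id
      measurable_const
  exact (hm.comp_aemeasurable hf.aemeasurable).aestronglyMeasurable

/-- Truncations converge in the mixed norm, by dominated convergence in space and then in time;
this is where finiteness of both exponents enters. -/
theorem tendsto_mixedNorm_sub_trunc {p q : ℝ} (hp : 0 < p) (hq : 0 < q) {f : ℝ × Torus L → ℝ}
    (hf : MemMixed p q f) :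
    Tendsto (fun N => mixedNorm p q (fun z => f z - trunc N f z)) atTop (𝓝 0) := by
  have hsub : ∀ N, AEStronglyMeasurable (fun z => f z - trunc N f z) volume := fun N =>
    hf.1.sub (aestronglyMeasurable_trunc N hf.1)
  have hfin : ∫⁻ t, ((∫⁻ x, ‖f (t, x)‖ₑ ^ q) ^ (1 / q)) ^ p ≠ ⊤ := by
    intro h
    have := hf.2
    rw [mixedNorm, h, ENNReal.top_rpow_of_pos (by positivity)] at this
    exact lt_irrefl _ this
  have hslice : ∀ᵐ t : ℝ, (∫⁻ x, ‖f (t, x)‖ₑ ^ q) < ⊤ := by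
    have := ae_lt_top' (((aemeasurable_lintegral_slice hf.1 q).pow_const (1 / q)).pow_const p) hfin
    filter_upwards [this] with t ht
    by_contra h
    rw [not_lt, top_le_iff] at h
    simp [h, hp, hq] at ht
  have key : Tendsto (fun N => ∫⁻ t, ((∫⁻ x, ‖f (t, x) - trunc N f (t, x)‖ₑ ^ q) ^ (1 / q)) ^ p)
      atTop (𝓝 (∫⁻ _ : ℝ, 0)) := by
    apply tendsto_lintegral_of_dominated_convergence'
      (fun t => ((∫⁻ x, ‖f (t, x)‖ₑ ^ q) ^ (1 / q)) ^ p)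
    · exact fun N => ((aemeasurable_lintegral_slice (hsub N) q).pow_const _).pow_const _
    · intro N
      refine Eventually.of_forall fun t => ?_
      dsimp only
      gcongr
      exact enorm_sub_trunc_le _ _ _
    · exact hfin
    · have h1 : ∀ᵐ t : ℝ, ∀ N, AEMeasurable (fun x => f (t, x) - trunc N f (t, x)) volume :=
        ae_all_iff.2 fun N => aemeasurable_slice (hsub N)
      filter_upwards [hslice, h1] with t ht ht1
      have h2 : Tendsto (fun N => ∫⁻ x, ‖f (t, x) - trunc N f (t, x)‖ₑ ^ q) atTop
          (𝓝 (∫⁻ _ : Torus L, 0)) := by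
        apply tendsto_lintegral_of_dominated_convergence' (fun x => ‖f (t, x)‖ₑ ^ q)
        · exact fun N => (ht1 N).enorm.pow_const q
        · intro N
          refine Eventually.of_forall fun x => ?_
          dsimp only
          gcongr
          exact enorm_sub_trunc_le _ _ _
        · exact ht.ne
        · refine Eventually.of_forall fun x => ?_
          have := ((ENNReal.continuous_rpow_const (y := q)).tendsto 0).comp
            (tendsto_sub_trunc f (t, x))
          simpa [hq, Function.comp_def] using this
      have h3 := ((ENNReal.continuous_rpow_const (y := p)).tendsto _).comp
        (((ENNReal.continuous_rpow_const (y := 1 / q)).tendsto _).comp h2)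
      simpa [hq, hp, Function.comp_def] using h3
  have := ((ENNReal.continuous_rpow_const (y := 1 / p)).tendsto _).comp key
  simpa [hp, Function.comp_def, mixedNorm] using this

end

section

variable {L : ℝ} [Fact (0 < L)]

/-! ### Continuity of translations -/

theorem measurePreserving_add_right' (h : ℝ × Torus L) :
    MeasurePreserving (fun z : ℝ × Torus L => z + h) volume volume :=
  measurePreserving_add_right volume h

theorem aestronglyMeasurable_comp_add {f : ℝ × Torus L → ℝ} (hf : AEStronglyMeasurable f volume)
    (h : ℝ × Torus L) : AEStronglyMeasurable (fun z => f (z + h)) volume :=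
  hf.comp_measurePreserving (measurePreserving_add_right' h)

/-- Translations act continuously on `L¹`. -/
theorem tendsto_lintegral_translate_sub {f : ℝ × Torus L → ℝ} (hf : Integrable f)
    (h₀ : ℝ × Torus L) :
    Tendsto (fun h => ∫⁻ z, ‖f (z + h) - f (z + h₀)‖ₑ) (𝓝 h₀) (𝓝 0) := by
  let g : (ℝ × Torus L) → C(ℝ × Torus L, ℝ × Torus L) := fun h => ⟨fun z => z + h, by fun_prop⟩
  have hg : Continuous g :=
    ContinuousMap.continuous_of_continuous_uncurry _ (by
      change Continuous fun x : (ℝ × Torus L) × (ℝ × Torus L) => x.2 + x.1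
      fun_prop)
  have hgm : ∀ h, MeasurePreserving (g h) volume volume := measurePreserving_add_right'
  have hf' : MemLp f 1 := memLp_one_iff_integrable.2 hf
  have key : Tendsto (fun h => Lp.compMeasurePreserving (g h) (hgm h) (hf'.toLp f)) (𝓝 h₀)
      (𝓝 (Lp.compMeasurePreserving (g h₀) (hgm h₀) (hf'.toLp f))) :=
    tendsto_const_nhds.compMeasurePreservingLp (hg.tendsto h₀) hgm (hgm h₀) (by simp)
  rw [tendsto_iff_edist_tendsto_0] at key
  refine key.congr fun h => ?_
  rw [Lp.toLp_compMeasurePreserving, Lp.toLp_compMeasurePreserving, Lp.edist_toLp_toLp,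
    eLpNorm_one_eq_lintegral_enorm]
  rfl

/-! ### Trilinear correlations -/

/-- The trilinear correlation `∫ a(z + h₁) b(z + h₂) c(z + h₃) χ(z) dz`. -/
def tri (a b c χ : ℝ × Torus L → ℝ) (h : (ℝ × Torus L) × (ℝ × Torus L) × (ℝ × Torus L)) : ℝ :=
  ∫ z, a (z + h.1) * b (z + h.2.1) * c (z + h.2.2) * χ z

/-- Trilinear correlations converge absolutely, with a bound independent of the increments. -/
theorem lintegral_tri_le {p q m n : ℝ} (e : HolderExponents p q m n) {a b c χ : ℝ × Torus L → ℝ}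
    (ha : AEStronglyMeasurable a volume) (hb : AEStronglyMeasurable b volume)
    (hc : AEStronglyMeasurable c volume) {K : ℝ} (hχK : ∀ z, ‖χ z‖ ≤ K)
    (h₁ h₂ h₃ : ℝ × Torus L) :
    ∫⁻ z, ‖a (z + h₁) * b (z + h₂) * c (z + h₃) * χ z‖ₑ ≤
      mixedNorm p q a * mixedNorm p q b * mixedNorm m n c * ENNReal.ofReal K := by
  calc _ ≤ ∫⁻ z, (‖a (z + h₁)‖ₑ * ‖b (z + h₂)‖ₑ * ‖c (z + h₃)‖ₑ) * ENNReal.ofReal K := by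
        apply lintegral_mono fun z => ?_
        simp only [enorm_mul]
        gcongr
        rw [← ofReal_norm]
        exact ENNReal.ofReal_le_ofReal (hχK z)
    _ = (∫⁻ z, ‖a (z + h₁)‖ₑ * ‖b (z + h₂)‖ₑ * ‖c (z + h₃)‖ₑ) * ENNReal.ofReal K :=
        lintegral_mul_const' _ _ ENNReal.ofReal_ne_top
    _ ≤ _ := by
        gcongr
        have := lintegral_mul_mul_le_mixedNorm e (aestronglyMeasurable_comp_add ha h₁)
          (aestronglyMeasurable_comp_add hb h₂) (aestronglyMeasurable_comp_add hc h₃)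
        rwa [mixedNorm_comp_add p q a, mixedNorm_comp_add p q b, mixedNorm_comp_add m n c] at this

theorem aestronglyMeasurable_tri {a b c χ : ℝ × Torus L → ℝ}
    (ha : AEStronglyMeasurable a volume) (hb : AEStronglyMeasurable b volume)
    (hc : AEStronglyMeasurable c volume) (hχ : AEStronglyMeasurable χ volume)
    (h₁ h₂ h₃ : ℝ × Torus L) :
    AEStronglyMeasurable (fun z => a (z + h₁) * b (z + h₂) * c (z + h₃) * χ z) volume :=
  (((aestronglyMeasurable_comp_add ha h₁).mul (aestronglyMeasurable_comp_add hb h₂)).mul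
    (aestronglyMeasurable_comp_add hc h₃)).mul hχ

theorem integrable_tri {p q m n : ℝ} (e : HolderExponents p q m n) {a b c χ : ℝ × Torus L → ℝ}
    (ha : MemMixed p q a) (hb : MemMixed p q b) (hc : MemMixed m n c)
    (hχ : AEStronglyMeasurable χ volume) {K : ℝ} (hχK : ∀ z, ‖χ z‖ ≤ K)
    (h₁ h₂ h₃ : ℝ × Torus L) :
    Integrable (fun z => a (z + h₁) * b (z + h₂) * c (z + h₃) * χ z) := by
  refine ⟨aestronglyMeasurable_tri ha.1 hb.1 hc.1 hχ _ _ _,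
    (lintegral_tri_le e ha.1 hb.1 hc.1 hχK h₁ h₂ h₃).trans_lt ?_⟩
  exact ENNReal.mul_lt_top (ENNReal.mul_lt_top (ENNReal.mul_lt_top ha.2 hb.2) hc.2)
    ENNReal.ofReal_lt_top

/-- Truncated functions vanishing outside a set of finite measure are integrable. -/
theorem integrable_trunc {S : Set (ℝ × Torus L)} (hS : volume S < ⊤)
    {f : ℝ × Torus L → ℝ} (hf : AEStronglyMeasurable f volume) (hfS : ∀ z ∉ S, f z = 0) (N : ℕ) :
    Integrable (trunc N f) := by
  have h1 : IntegrableOn (trunc N f) S volume :=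
    Measure.integrableOn_of_bounded hS.ne (aestronglyMeasurable_trunc N hf)
      (Eventually.of_forall (norm_trunc_le N f))
  refine (integrableOn_iff_integrable_of_support_subset fun z hz => ?_).1 h1
  by_contra hzS
  exact hz (by simp [trunc, hfS z hzS])

/-- Telescoping of a difference of products, one factor at a time. -/
theorem enorm_mul_mul_mul_sub_le {a b c a' b' c' x : ℝ} :
    ‖a * b * c * x - a' * b' * c' * x‖ₑ ≤
      ‖(a - a') * b * c * x‖ₑ + ‖a' * (b - b') * c * x‖ₑ + ‖a' * b' * (c - c') * x‖ₑ := by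
  have : a * b * c * x - a' * b' * c' * x
      = (a - a') * b * c * x + a' * (b - b') * c * x + a' * b' * (c - c') * x := by ring
  rw [this]
  exact (enorm_add_le _ _).trans (by gcongr; exact enorm_add_le _ _)

/-- For bounded integrable factors the correlation is continuous, since translations are continuous
in `L¹` and the other two factors are bounded. -/
theorem continuous_tri_of_bounded {a b c χ : ℝ × Torus L → ℝ} {N : ℕ}
    (ha : Integrable a) (hb : Integrable b) (hc : Integrable c)
    (haN : ∀ z, ‖a z‖ ≤ N) (hbN : ∀ z, ‖b z‖ ≤ N) (hcN : ∀ z, ‖c z‖ ≤ N)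
    (hχ : AEStronglyMeasurable χ volume) {K : ℝ} (hχK : ∀ z, ‖χ z‖ ≤ K) :
    Continuous (tri a b c χ) := by
  have hN : (0 : ℝ) ≤ N := by positivity
  have hK : 0 ≤ K := (norm_nonneg _).trans (hχK 0)
  have toE : ∀ {x y : ℝ}, ‖x‖ ≤ y → ‖x‖ₑ ≤ ENNReal.ofReal y := fun h => by
    rw [← ofReal_norm]; exact ENNReal.ofReal_le_ofReal h
  have hint : ∀ h : (ℝ × Torus L) × (ℝ × Torus L) × (ℝ × Torus L),
      Integrable fun z => a (z + h.1) * b (z + h.2.1) * c (z + h.2.2) * χ z := fun h => by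
    have h1 : Integrable fun z => a (z + h.1) := ha.comp_add_right h.1
    refine ((h1.mul_bdd (c := N) ?_ ?_).mul_bdd (c := N) ?_ ?_).mul_bdd (c := K) hχ
      (Eventually.of_forall hχK)
    · exact aestronglyMeasurable_comp_add hb.1 _
    · exact Eventually.of_forall fun z => hbN _
    · exact aestronglyMeasurable_comp_add hc.1 _
    · exact Eventually.of_forall fun z => hcN _
  rw [continuous_iff_continuousAt]
  intro h₀
  refine tendsto_integral_of_L1 _ (hint h₀).1 (Eventually.of_forall hint) ?_
  set C : ℝ≥0∞ := ENNReal.ofReal N * ENNReal.ofReal N * ENNReal.ofReal K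
  have hC : C ≠ ⊤ := by finiteness
  have t1 := (tendsto_lintegral_translate_sub ha h₀.1).comp
    (continuous_fst.tendsto h₀)
  have t2 := (tendsto_lintegral_translate_sub hb h₀.2.1).comp
    ((continuous_fst.comp continuous_snd).tendsto h₀)
  have t3 := (tendsto_lintegral_translate_sub hc h₀.2.2).comp
    ((continuous_snd.comp continuous_snd).tendsto h₀)
  have t := (((ENNReal.Tendsto.mul_const t1 (Or.inr hC)).add
    (ENNReal.Tendsto.mul_const t2 (Or.inr hC))).add (ENNReal.Tendsto.mul_const t3 (Or.inr hC)))
  simp only [zero_mul, add_zero, Function.comp_def] at t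
  refine tendsto_of_tendsto_of_tendsto_of_le_of_le tendsto_const_nhds t (fun _ => zero_le) ?_
  intro h
  dsimp only
  rw [← lintegral_mul_const' _ _ hC, ← lintegral_mul_const' _ _ hC, ← lintegral_mul_const' _ _ hC]
  have m1 : AEMeasurable (fun z => ‖a (z + h.1) - a (z + h₀.1)‖ₑ * C) volume :=
    ((aestronglyMeasurable_comp_add ha.1 _).sub
      (aestronglyMeasurable_comp_add ha.1 _)).enorm.mul_const _
  have m2 : AEMeasurable (fun z => ‖b (z + h.2.1) - b (z + h₀.2.1)‖ₑ * C) volume :=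
    ((aestronglyMeasurable_comp_add hb.1 _).sub
      (aestronglyMeasurable_comp_add hb.1 _)).enorm.mul_const _
  have m12 : AEMeasurable (fun z => ‖a (z + h.1) - a (z + h₀.1)‖ₑ * C
      + ‖b (z + h.2.1) - b (z + h₀.2.1)‖ₑ * C) volume := m1.add m2
  rw [← lintegral_add_left' m1, ← lintegral_add_left' m12]
  apply lintegral_mono fun z => ?_
  refine enorm_mul_mul_mul_sub_le.trans ?_
  simp only [enorm_mul, C]
  have e1 := toE (hbN (z + h.2.1))
  have e2 := toE (hcN (z + h.2.2))
  have e3 := toE (haN (z + h₀.1))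
  have e4 := toE (hbN (z + h₀.2.1))
  have e5 := toE (hχK z)
  gcongr ?_ + ?_ + ?_
  · calc _ ≤ ‖a (z + h.1) - a (z + h₀.1)‖ₑ * ENNReal.ofReal N * ENNReal.ofReal N
          * ENNReal.ofReal K := by gcongr
      _ = _ := by ring
  · calc _ ≤ ENNReal.ofReal N * ‖b (z + h.2.1) - b (z + h₀.2.1)‖ₑ * ENNReal.ofReal N
          * ENNReal.ofReal K := by gcongr
      _ = _ := by ring
  · calc _ ≤ ENNReal.ofReal N * ENNReal.ofReal N * ‖c (z + h.2.2) - c (z + h₀.2.2)‖ₑ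
          * ENNReal.ofReal K := by gcongr
      _ = _ := by ring

theorem memMixed_trunc {p q : ℝ} (hp : 0 < p) (hq : 0 < q) {f : ℝ × Torus L → ℝ}
    (hf : MemMixed p q f) (N : ℕ) : MemMixed p q (trunc N f) :=
  ⟨aestronglyMeasurable_trunc N hf.1,
    (mixedNorm_mono hp hq (enorm_trunc_le N f)).trans_lt hf.2⟩

/-- The trilinear correlation depends continuously on the three increments: by Hölder's
inequality it is the uniform limit of the correlations of the truncated functions. -/
theorem continuous_tri {p q m n : ℝ} (e : HolderExponents p q m n) {S : Set (ℝ × Torus L)}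
    (hS : volume S < ⊤) {a b c χ : ℝ × Torus L → ℝ}
    (ha : MemMixed p q a) (hb : MemMixed p q b) (hc : MemMixed m n c)
    (haS : ∀ z ∉ S, a z = 0) (hbS : ∀ z ∉ S, b z = 0) (hcS : ∀ z ∉ S, c z = 0)
    (hχ : AEStronglyMeasurable χ volume) {K : ℝ} (hχK : ∀ z, ‖χ z‖ ≤ K) :
    Continuous (tri a b c χ) := by
  set X : (ℝ × Torus L → ℝ) → ℝ≥0∞ := mixedNorm p q
  set Y : (ℝ × Torus L → ℝ) → ℝ≥0∞ := mixedNorm m n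
  set B : ℕ → ℝ≥0∞ := fun N =>
    X (fun z => a z - trunc N a z) * X b * Y c * ENNReal.ofReal K
      + X a * X (fun z => b z - trunc N b z) * Y c * ENNReal.ofReal K
      + X a * X b * Y (fun z => c z - trunc N c z) * ENNReal.ofReal K
  have hB : Tendsto B atTop (𝓝 0) := by
    have t1 := tendsto_mixedNorm_sub_trunc e.hp e.hq ha
    have t2 := tendsto_mixedNorm_sub_trunc e.hp e.hq hb
    have t3 := tendsto_mixedNorm_sub_trunc e.hm e.hn hc
    have a2 := ha.2.ne
    have b2 := hb.2.ne
    have c2 := hc.2.ne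
    have u1 := ENNReal.Tendsto.mul_const (b := ENNReal.ofReal K) (ENNReal.Tendsto.mul_const
      (ENNReal.Tendsto.mul_const t1 (Or.inr b2)) (Or.inr c2)) (Or.inr ENNReal.ofReal_ne_top)
    have u2 := ENNReal.Tendsto.mul_const (b := ENNReal.ofReal K) (ENNReal.Tendsto.mul_const
      (ENNReal.Tendsto.const_mul t2 (Or.inr a2)) (Or.inr c2)) (Or.inr ENNReal.ofReal_ne_top)
    have u3 := ENNReal.Tendsto.mul_const (b := ENNReal.ofReal K)
      (ENNReal.Tendsto.const_mul t3 (Or.inr (ENNReal.mul_ne_top a2 b2)))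
      (Or.inr ENNReal.ofReal_ne_top)
    simpa using (u1.add u2).add u3
  have hbound : ∀ N h, edist (tri a b c χ h) (tri (trunc N a) (trunc N b) (trunc N c) χ h) ≤ B N := by
    intro N h
    have ha' := memMixed_trunc e.hp e.hq ha N
    have hb' := memMixed_trunc e.hp e.hq hb N
    have hc' := memMixed_trunc e.hm e.hn hc N
    have da : AEStronglyMeasurable (fun z => a z - trunc N a z) volume := ha.1.sub ha'.1
    have db : AEStronglyMeasurable (fun z => b z - trunc N b z) volume := hb.1.sub hb'.1
    have dc : AEStronglyMeasurable (fun z => c z - trunc N c z) volume := hc.1.sub hc'.1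
    rw [edist_eq_enorm_sub, tri, tri, ← integral_sub (integrable_tri e ha hb hc hχ hχK _ _ _)
      (integrable_tri e ha' hb' hc' hχ hχK _ _ _)]
    refine (enorm_integral_le_lintegral_enorm _).trans ?_
    refine (lintegral_mono fun z => enorm_mul_mul_mul_sub_le).trans ?_
    have m1 := (aestronglyMeasurable_tri da hb.1 hc.1 hχ h.1 h.2.1 h.2.2).enorm
    have m2 := (aestronglyMeasurable_tri ha'.1 db hc.1 hχ h.1 h.2.1 h.2.2).enorm
    have m12 : AEMeasurable (fun z =>
        ‖(a (z + h.1) - trunc N a (z + h.1)) * b (z + h.2.1) * c (z + h.2.2) * χ z‖ₑ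
        + ‖trunc N a (z + h.1) * (b (z + h.2.1) - trunc N b (z + h.2.1)) * c (z + h.2.2) * χ z‖ₑ)
        volume := m1.add m2
    rw [lintegral_add_left' m12, lintegral_add_left' m1]
    have la : X (trunc N a) ≤ X a := mixedNorm_mono e.hp e.hq (enorm_trunc_le N a)
    have lb : X (trunc N b) ≤ X b := mixedNorm_mono e.hp e.hq (enorm_trunc_le N b)
    refine add_le_add (add_le_add ?_ ?_) ?_
    · exact lintegral_tri_le e da hb.1 hc.1 hχK h.1 h.2.1 h.2.2
    · exact (lintegral_tri_le e ha'.1 db hc.1 hχK h.1 h.2.1 h.2.2).trans (by gcongr)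
    · exact (lintegral_tri_le e ha'.1 hb'.1 dc hχK h.1 h.2.1 h.2.2).trans (by gcongr)
  refine continuous_of_uniform_approx_of_continuous fun u hu => ?_
  obtain ⟨ε, hε, hεu⟩ := mem_uniformity_edist.1 hu
  obtain ⟨N, hN⟩ := (hB.eventually (gt_mem_nhds hε)).exists
  refine ⟨tri (trunc N a) (trunc N b) (trunc N c) χ,
    continuous_tri_of_bounded (integrable_trunc hS ha.1 haS N)
      (integrable_trunc hS hb.1 hbS N) (integrable_trunc hS hc.1 hcS N)
      (norm_trunc_le N a) (norm_trunc_le N b) (norm_trunc_le N c) hχ hχK, fun h => ?_⟩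
  exact hεu ((hbound N h).trans_lt hN)

end

section

variable {L : ℝ} [Fact (0 < L)]

/-! ### Fubini for correlations -/

section Family

variable {Λ : Type*} [MeasurableSpace Λ] {μ : Measure Λ} [SFinite μ]

/-- Joint measurability in the parameter and the point: shearing by `Y` preserves the product
measure, so it is harmless that `f` is only almost everywhere measurable. -/
theorem aestronglyMeasurable_comp_add_prod {f : ℝ × Torus L → ℝ}
    (hf : AEStronglyMeasurable f volume) {Y : Λ → ℝ × Torus L} (hY : Measurable Y) :
    AEStronglyMeasurable (fun x : Λ × (ℝ × Torus L) => f (x.2 + Y x.1)) (μ.prod volume) := by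
  have h : MeasurePreserving (fun x : Λ × (ℝ × Torus L) => (x.1, x.2 + Y x.1))
      (μ.prod volume) (μ.prod volume) := by
    refine (MeasurePreserving.id μ).skew_product (g := fun l z => z + Y l) ?_ ?_
    · exact measurable_snd.add (hY.comp measurable_fst)
    · exact Eventually.of_forall fun l => (measurePreserving_add_right' (Y l)).map_eq
  exact (hf.comp_snd (μ := μ)).comp_measurePreserving h

/-- Absolute convergence of a weighted superposition of trilinear correlations. -/
theorem integrable_prod_tri {p q m n : ℝ} (e : HolderExponents p q m n)
    {a b c χ : ℝ × Torus L → ℝ} (ha : MemMixed p q a) (hb : MemMixed p q b)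
    (hc : MemMixed m n c) (hχ : AEStronglyMeasurable χ volume) {K : ℝ} (hχK : ∀ z, ‖χ z‖ ≤ K)
    {W : Λ → ℝ} (hW : Integrable W μ) {Y₁ Y₂ Y₃ : Λ → ℝ × Torus L} (h₁ : Measurable Y₁)
    (h₂ : Measurable Y₂) (h₃ : Measurable Y₃) :
    Integrable (fun x : Λ × (ℝ × Torus L) =>
      W x.1 * (a (x.2 + Y₁ x.1) * b (x.2 + Y₂ x.1) * c (x.2 + Y₃ x.1) * χ x.2))
      (μ.prod volume) := by
  have hm : AEStronglyMeasurable (fun x : Λ × (ℝ × Torus L) =>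
      W x.1 * (a (x.2 + Y₁ x.1) * b (x.2 + Y₂ x.1) * c (x.2 + Y₃ x.1) * χ x.2))
      (μ.prod volume) :=
    hW.1.comp_fst.mul ((((aestronglyMeasurable_comp_add_prod ha.1 h₁).mul
      (aestronglyMeasurable_comp_add_prod hb.1 h₂)).mul
      (aestronglyMeasurable_comp_add_prod hc.1 h₃)).mul hχ.comp_snd)
  refine ⟨hm, ?_⟩
  rw [HasFiniteIntegral, lintegral_prod _ hm.enorm]
  set C := mixedNorm p q a * mixedNorm p q b * mixedNorm m n c * ENNReal.ofReal K
  have hC : C < ⊤ := ENNReal.mul_lt_top (ENNReal.mul_lt_top (ENNReal.mul_lt_top ha.2 hb.2) hc.2)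
    ENNReal.ofReal_lt_top
  calc _ ≤ ∫⁻ l, ‖W l‖ₑ * C ∂μ := by
        apply lintegral_mono fun l => ?_
        simp_rw [enorm_mul (W l)]
        rw [lintegral_const_mul' _ _ enorm_ne_top]
        gcongr
        exact lintegral_tri_le e ha.1 hb.1 hc.1 hχK _ _ _
    _ = (∫⁻ l, ‖W l‖ₑ ∂μ) * C := lintegral_mul_const' _ _ hC.ne
    _ < ⊤ := ENNReal.mul_lt_top hW.2 hC

end Family

/-- The correlation `h ↦ ∫ α(z) β(z + h) dz`. -/
def corr (α β : ℝ × Torus L → ℝ) (h : ℝ × Torus L) : ℝ := ∫ z, α z * β (z + h)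

/-- Pairs of integrable functions for which the correlation integrals converge absolutely,
uniformly in the increment, and depend continuously on it. -/
structure CorrPair (α β : ℝ × Torus L → ℝ) : Prop where
  integrable_left : Integrable α
  integrable_right : Integrable β
  bound : ∃ C < (⊤ : ℝ≥0∞), ∀ h, ∫⁻ z, ‖α z * β (z + h)‖ₑ ≤ C
  continuous_corr : Continuous (corr α β)

theorem CorrPair.integrable_prod_add {α β κ : ℝ × Torus L → ℝ} (P : CorrPair α β)
    (hκ : Integrable κ) :
    Integrable (fun x : (ℝ × Torus L) × (ℝ × Torus L) => κ x.2 * (α x.1 * β (x.1 + x.2)))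
      (volume.prod volume) := by
  rw [← integrable_swap_iff]
  have hm : AEStronglyMeasurable (fun x : (ℝ × Torus L) × (ℝ × Torus L) =>
      κ x.1 * (α x.2 * β (x.2 + x.1))) (volume.prod volume) :=
    hκ.1.comp_fst.mul (P.integrable_left.1.comp_snd.mul
      (aestronglyMeasurable_comp_add_prod P.integrable_right.1 measurable_id))
  refine ⟨hm, ?_⟩
  obtain ⟨C, hC, hPC⟩ := P.bound
  rw [HasFiniteIntegral]
  change ∫⁻ x : (ℝ × Torus L) × (ℝ × Torus L), ‖κ x.1 * (α x.2 * β (x.2 + x.1))‖ₑ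
    ∂(volume.prod volume) < ⊤
  rw [lintegral_prod _ hm.enorm]
  calc _ ≤ ∫⁻ h, ‖κ h‖ₑ * C := by
        apply lintegral_mono fun h => ?_
        simp_rw [enorm_mul (κ h)]
        rw [lintegral_const_mul' _ _ enorm_ne_top]
        gcongr
        exact hPC h
    _ = (∫⁻ h, ‖κ h‖ₑ) * C := lintegral_mul_const' _ _ hC.ne
    _ < ⊤ := ENNReal.mul_lt_top hκ.2 hC

theorem CorrPair.integrable_prod_sub {α β κ : ℝ × Torus L → ℝ} (P : CorrPair α β)
    (hκ : Integrable κ) :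
    Integrable (fun x : (ℝ × Torus L) × (ℝ × Torus L) => κ (x.2 - x.1) * (α x.1 * β x.2))
      (volume.prod volume) := by
  have h := measurePreserving_prod_add (volume : Measure (ℝ × Torus L))
    (volume : Measure (ℝ × Torus L))
  have he : MeasurableEmbedding fun x : (ℝ × Torus L) × (ℝ × Torus L) => (x.1, x.1 + x.2) :=
    (MeasurableEquiv.shearAddRight (ℝ × Torus L)).measurableEmbedding
  rw [← h.integrable_comp_emb he]
  refine (P.integrable_prod_add hκ).congr (Eventually.of_forall fun x => ?_)
  simp

theorem CorrPair.integrable_integral_right {α β κ : ℝ × Torus L → ℝ} (P : CorrPair α β)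
    (hκ : Integrable κ) : Integrable fun z => α z * ∫ w, κ (w - z) * β w := by
  refine (P.integrable_prod_sub hκ).integral_prod_left.congr (Eventually.of_forall fun z => ?_)
  dsimp only
  rw [← integral_const_mul]
  congr 1 with w
  ring

theorem CorrPair.integrable_integral_left {α β κ : ℝ × Torus L → ℝ} (P : CorrPair α β)
    (hκ : Integrable κ) : Integrable fun w => β w * ∫ z, κ (w - z) * α z := by
  refine (P.integrable_prod_sub hκ).integral_prod_right.congr (Eventually.of_forall fun w => ?_)
  dsimp only
  rw [← integral_const_mul]
  congr 1 with z
  ring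

/-- Averaging a correlation against a kernel: the kernel may be applied to the right factor. -/
theorem CorrPair.integral_mul_corr_right {α β κ : ℝ × Torus L → ℝ} (P : CorrPair α β)
    (hκ : Integrable κ) : ∫ h, κ h * corr α β h = ∫ z, α z * ∫ w, κ (w - z) * β w := by
  calc ∫ h, κ h * corr α β h = ∫ h, ∫ z, κ h * (α z * β (z + h)) := by
        simp_rw [corr, integral_const_mul]
    _ = ∫ z, ∫ h, κ h * (α z * β (z + h)) :=
        (integral_integral_swap (f := fun z h => κ h * (α z * β (z + h)))
          (P.integrable_prod_add hκ)).symm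
    _ = _ := by
        congr 1 with z
        rw [← integral_const_mul, ← integral_add_left_eq_self (fun w => α z * (κ (w - z) * β w)) z]
        congr 1 with h
        rw [add_sub_cancel_left]
        ring

/-- Averaging a correlation against a kernel: the kernel may be applied to the left factor. -/
theorem CorrPair.integral_mul_corr_left {α β κ : ℝ × Torus L → ℝ} (P : CorrPair α β)
    (hκ : Integrable κ) : ∫ h, κ h * corr α β h = ∫ w, β w * ∫ z, κ (w - z) * α z := by
  rw [P.integral_mul_corr_right hκ]
  calc _ = ∫ z, ∫ w, κ (w - z) * (α z * β w) := by
        congr 1 with z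
        rw [← integral_const_mul]
        congr 1 with w
        ring
    _ = ∫ w, ∫ z, κ (w - z) * (α z * β w) :=
        integral_integral_swap (f := fun z w => κ (w - z) * (α z * β w)) (P.integrable_prod_sub hκ)
    _ = _ := by
        congr 1 with w
        rw [← integral_const_mul]
        congr 1 with z
        ring

end

section

variable {L : ℝ}

/-! ### Calculus of functions periodic in space -/

theorem proj_add (l l' : E3) : proj L (l + l') = proj L l + proj L l' := by
  ext i; simp [proj]

theorem proj_neg (l : E3) : proj L (-l) = -proj L l := by
  ext i; simp [proj]

theorem proj_sub (l l' : E3) : proj L (l - l') = proj L l - proj L l' := by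
  ext i; simp [proj]

@[simp] theorem proj_zero : proj L 0 = 0 := by
  ext i; simp [proj]

theorem isOpenQuotientMap_proj : IsOpenQuotientMap (proj L) := by
  have h : IsOpenQuotientMap (Pi.map fun (_ : Fin 3) (r : ℝ) => (r : AddCircle L)) :=
    IsOpenQuotientMap.piMap fun _ => QuotientAddGroup.isOpenQuotientMap_mk
  exact h.comp (EuclideanSpace.equiv (Fin 3) ℝ).toHomeomorph.isOpenQuotientMap

theorem continuous_proj : Continuous (proj L) := isOpenQuotientMap_proj.continuous

theorem proj_surjective : Function.Surjective (proj L) := isOpenQuotientMap_proj.surjective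

theorem continuous_of_continuous_lift {f : ℝ × Torus L → ℝ} (hf : Continuous (lift f)) :
    Continuous f := by
  have h : IsOpenQuotientMap (Prod.map (id : ℝ → ℝ) (proj L)) :=
    IsOpenQuotientMap.id.prodMap isOpenQuotientMap_proj
  exact h.isQuotientMap.continuous_iff.2 hf

/-- The standard basis of `ℝ³`. -/
def basisVec (i : Fin 3) : E3 := EuclideanSpace.single i 1

/-- The partial derivative `∂f/∂xᵢ` in space. -/
def pd (i : Fin 3) (f : ℝ × Torus L → ℝ) (z : ℝ × Torus L) : ℝ :=
  deriv (fun τ : ℝ => f (z.1, z.2 + proj L (τ • basisVec i))) 0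

/-- Smoothness of a function on `ℝ × 𝕋³`. -/
def SmoothPer (f : ℝ × Torus L → ℝ) : Prop := ContDiff ℝ ∞ (lift f)

theorem SmoothPer.continuous {f : ℝ × Torus L → ℝ} (hf : SmoothPer f) : Continuous f :=
  continuous_of_continuous_lift (ContDiff.continuous hf)

theorem SmoothPer.hasFDerivAt {f : ℝ × Torus L → ℝ} (hf : SmoothPer f) (z : ℝ × E3) :
    HasFDerivAt (lift f) (fderiv ℝ (lift f) z) z :=
  (ContDiff.differentiable hf (by simp) z).hasFDerivAt

theorem SmoothPer.hasDerivAt_time {f : ℝ × Torus L → ℝ} (hf : SmoothPer f) (t : ℝ) (l : E3) :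
    HasDerivAt (fun s => f (s, proj L l)) (fderiv ℝ (lift f) (t, l) (1, 0)) t := by
  have h : HasDerivAt (fun s : ℝ => (s, l)) ((1 : ℝ), (0 : E3)) t :=
    (hasDerivAt_id t).prodMk (hasDerivAt_const t l)
  exact (hf.hasFDerivAt (t, l)).comp_hasDerivAt t h

theorem SmoothPer.hasDerivAt_space {f : ℝ × Torus L → ℝ} (hf : SmoothPer f) (t : ℝ) (l e : E3) :
    HasDerivAt (fun τ : ℝ => f (t, proj L l + proj L (τ • e)))
      (fderiv ℝ (lift f) (t, l) (0, e)) 0 := by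
  have h1 : HasDerivAt (fun τ : ℝ => l + τ • e) e 0 := by
    simpa using ((hasDerivAt_id (0 : ℝ)).smul_const e).const_add l
  have h : HasDerivAt (fun τ : ℝ => (t, l + τ • e)) ((0 : ℝ), e) 0 :=
    (hasDerivAt_const 0 t).prodMk h1
  have h2 := (hf.hasFDerivAt (t, l + (0 : ℝ) • e)).comp_hasDerivAt (0 : ℝ) h
  simp only [zero_smul, add_zero] at h2
  refine h2.congr_of_eventuallyEq (Eventually.of_forall fun τ => ?_)
  simp [lift, proj_add]

theorem SmoothPer.dt_eq {f : ℝ × Torus L → ℝ} (hf : SmoothPer f) (t : ℝ) (l : E3) :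
    dt f (t, proj L l) = fderiv ℝ (lift f) (t, l) (1, 0) :=
  (hf.hasDerivAt_time t l).deriv

theorem SmoothPer.pd_eq {f : ℝ × Torus L → ℝ} (hf : SmoothPer f) (i : Fin 3) (t : ℝ) (l : E3) :
    pd i f (t, proj L l) = fderiv ℝ (lift f) (t, l) (0, basisVec i) :=
  (hf.hasDerivAt_space t l (basisVec i)).deriv

theorem SmoothPer.hasDerivAt_dt {f : ℝ × Torus L → ℝ} (hf : SmoothPer f) (z : ℝ × Torus L) :
    HasDerivAt (fun s => f (s, z.2)) (dt f z) z.1 := by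
  obtain ⟨t, x⟩ := z
  obtain ⟨l, rfl⟩ := proj_surjective x
  rw [hf.dt_eq]
  exact hf.hasDerivAt_time t l

theorem SmoothPer.hasDerivAt_pd {f : ℝ × Torus L → ℝ} (hf : SmoothPer f) (i : Fin 3)
    (z : ℝ × Torus L) :
    HasDerivAt (fun τ : ℝ => f (z.1, z.2 + proj L (τ • basisVec i))) (pd i f z) 0 := by
  obtain ⟨t, x⟩ := z
  obtain ⟨l, rfl⟩ := proj_surjective x
  rw [hf.pd_eq]
  exact hf.hasDerivAt_space t l _

theorem SmoothPer.continuous_dt {f : ℝ × Torus L → ℝ} (hf : SmoothPer f) :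
    Continuous (dt f) := by
  apply continuous_of_continuous_lift
  have : lift (dt f) = fun z => fderiv ℝ (lift f) z (1, 0) := by
    ext ⟨t, l⟩; exact hf.dt_eq t l
  rw [this]
  exact (ContDiff.continuous_fderiv hf (by simp)).clm_apply continuous_const

theorem SmoothPer.continuous_pd {f : ℝ × Torus L → ℝ} (hf : SmoothPer f) (i : Fin 3) :
    Continuous (pd i f) := by
  apply continuous_of_continuous_lift
  have : lift (pd i f) = fun z => fderiv ℝ (lift f) z (0, basisVec i) := by
    ext ⟨t, l⟩; exact hf.pd_eq i t l
  rw [this]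
  exact (ContDiff.continuous_fderiv hf (by simp)).clm_apply continuous_const

theorem inner_eq_sum (u w : E3) : inner ℝ u w = ∑ i, u i * w i := by
  simp [PiLp.inner_apply, mul_comm]

theorem SmoothPer.gradx_apply {f : ℝ × Torus L → ℝ} (hf : SmoothPer f) (z : ℝ × Torus L)
    (i : Fin 3) : gradx f z i = pd i f z := by
  obtain ⟨t, x⟩ := z
  obtain ⟨l, rfl⟩ := proj_surjective x
  have h0 : HasFDerivAt (fun l' : E3 => (t, l + l')) (ContinuousLinearMap.inr ℝ ℝ E3) 0 := by
    have := (hasFDerivAt_const t (0 : E3)).prodMk ((hasFDerivAt_id (𝕜 := ℝ) (0 : E3)).const_add l)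
    exact this
  have h1 : HasFDerivAt (fun l' : E3 => f (t, proj L l + proj L l'))
      ((fderiv ℝ (lift f) (t, l)).comp (ContinuousLinearMap.inr ℝ ℝ E3)) 0 := by
    have h2 := hf.hasFDerivAt (t, l + 0)
    have h3 := h2.comp (0 : E3) h0
    simp only [add_zero] at h3
    refine h3.congr_of_eventuallyEq (Eventually.of_forall fun τ => ?_)
    simp [lift, proj_add]
  have h4 : gradx f (t, proj L l) i = inner ℝ (gradx f (t, proj L l)) (basisVec i) := by
    simp [basisVec, EuclideanSpace.inner_single_right]
  rw [h4, hf.pd_eq, gradx, gradient, InnerProductSpace.toDual_symm_apply, h1.fderiv]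
  simp

theorem SmoothPer.inner_gradx {f : ℝ × Torus L → ℝ} (hf : SmoothPer f) (u : E3)
    (z : ℝ × Torus L) : inner ℝ u (gradx f z) = ∑ i, u i * pd i f z := by
  rw [inner_eq_sum]
  simp_rw [hf.gradx_apply]

theorem SmoothPer.mul {f g : ℝ × Torus L → ℝ} (hf : SmoothPer f) (hg : SmoothPer g) :
    SmoothPer fun z => f z * g z :=
  ContDiff.mul hf hg

theorem SmoothPer.dt_mul {f g : ℝ × Torus L → ℝ} (hf : SmoothPer f) (hg : SmoothPer g)
    (z : ℝ × Torus L) : dt (fun z => f z * g z) z = dt f z * g z + f z * dt g z :=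
  ((hf.hasDerivAt_dt z).mul (hg.hasDerivAt_dt z)).deriv

theorem SmoothPer.pd_mul {f g : ℝ × Torus L → ℝ} (hf : SmoothPer f) (hg : SmoothPer g)
    (i : Fin 3) (z : ℝ × Torus L) :
    pd i (fun z => f z * g z) z = pd i f z * g z + f z * pd i g z := by
  have h := ((hf.hasDerivAt_pd i z).mul (hg.hasDerivAt_pd i z)).deriv
  simp only [zero_smul, proj_zero, add_zero] at h
  exact h

theorem SmoothPer.comp_const_sub {f : ℝ × Torus L → ℝ} (hf : SmoothPer f) (w : ℝ × Torus L) :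
    SmoothPer fun z => f (w - z) := by
  obtain ⟨t, x⟩ := w
  obtain ⟨l, rfl⟩ := proj_surjective x
  have : lift (fun z => f ((t, proj L l) - z)) = lift f ∘ fun z => (t, l) - z := by
    ext z; simp [lift, proj_sub]
  rw [SmoothPer, this]
  exact ContDiff.comp hf (contDiff_const.sub contDiff_id)

theorem SmoothPer.comp_sub_const {f : ℝ × Torus L → ℝ} (hf : SmoothPer f) (w : ℝ × Torus L) :
    SmoothPer fun z => f (z - w) := by
  obtain ⟨t, x⟩ := w
  obtain ⟨l, rfl⟩ := proj_surjective x
  have : lift (fun z => f (z - (t, proj L l))) = lift f ∘ fun z => z - (t, l) := by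
    ext z; simp [lift, proj_sub]
  rw [SmoothPer, this]
  exact ContDiff.comp hf (contDiff_id.sub contDiff_const)

theorem SmoothPer.dt_comp_const_sub {f : ℝ × Torus L → ℝ} (hf : SmoothPer f)
    (w z : ℝ × Torus L) : dt (fun z => f (w - z)) z = -dt f (w - z) :=
  (HasDerivAt.comp_const_sub w.1 z.1 (hf.hasDerivAt_dt (w - z))).deriv

theorem SmoothPer.pd_comp_const_sub {f : ℝ × Torus L → ℝ} (hf : SmoothPer f) (i : Fin 3)
    (w z : ℝ × Torus L) : pd i (fun z => f (w - z)) z = -pd i f (w - z) := by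
  have h := hf.hasDerivAt_pd i (w - z)
  rw [show (0 : ℝ) = 0 - 0 by simp] at h
  have h2 := HasDerivAt.comp_const_sub 0 0 h
  rw [← h2.deriv]
  unfold pd
  congr 1
  ext τ
  refine congrArg f (Prod.ext (by simp) ?_)
  simp [neg_smul, proj_neg]
  abel

theorem dt_comp_sub_const (f : ℝ × Torus L → ℝ) (w z : ℝ × Torus L) :
    dt (fun z => f (z - w)) z = dt f (z - w) :=
  deriv_comp_sub_const (f := fun s => f (s, z.2 - w.2)) (x := z.1) w.1

theorem pd_comp_sub_const (f : ℝ × Torus L → ℝ) (i : Fin 3) (w z : ℝ × Torus L) :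
    pd i (fun z => f (z - w)) z = pd i f (z - w) := by
  unfold pd
  congr 1
  ext τ
  refine congrArg f (Prod.ext (by simp) ?_)
  simp
  abel

/-- The derivative along a coordinate line at an arbitrary parameter; `pd` itself is the derivative
at parameter `0`. -/
theorem SmoothPer.hasDerivAt_line {f : ℝ × Torus L → ℝ} (hf : SmoothPer f) (i : Fin 3)
    (t : ℝ) (x : Torus L) (τ : ℝ) :
    HasDerivAt (fun τ : ℝ => f (t, x + proj L (τ • basisVec i)))
      (pd i f (t, x + proj L (τ • basisVec i))) τ := by
  have h := hf.hasDerivAt_pd i (t, x + proj L (τ • basisVec i))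
  rw [show (0 : ℝ) = τ - τ by simp] at h
  have h2 := HasDerivAt.comp_sub_const τ τ h
  refine h2.congr_of_eventuallyEq (Eventually.of_forall fun s => ?_)
  dsimp only
  rw [add_assoc, ← proj_add, ← add_smul, add_sub_cancel]

/-- Vanishing for times outside a compact interval. -/
def TimeSupported (a b : ℝ) (f : ℝ × Torus L → ℝ) : Prop := ∀ t x, t ∉ Icc a b → f (t, x) = 0

theorem TimeSupported.dt {a b : ℝ} {f : ℝ × Torus L → ℝ} (hf : TimeSupported a b f) :
    TimeSupported a b (dt f) := by
  intro t x ht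
  have h : (fun s => f (s, x)) =ᶠ[𝓝 t] fun _ => 0 := by
    filter_upwards [isClosed_Icc.isOpen_compl.mem_nhds ht] with s hs
    exact hf s x hs
  simpa [Yaglom.dt] using h.deriv_eq

theorem TimeSupported.pd {a b : ℝ} {f : ℝ × Torus L → ℝ} (hf : TimeSupported a b f) (i : Fin 3) :
    TimeSupported a b (pd i f) := by
  intro t x ht
  have h : (fun τ : ℝ => f (t, x + proj L (τ • basisVec i))) = fun _ => 0 := by
    ext τ; exact hf t _ ht
  simp [Yaglom.pd, h]

variable [Fact (0 < L)]

theorem TimeSupported.hasCompactSupport {a b : ℝ} {f : ℝ × Torus L → ℝ}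
    (hf : TimeSupported a b f) : HasCompactSupport f := by
  refine HasCompactSupport.intro (isCompact_Icc (a := a) (b := b) |>.prod isCompact_univ) ?_
  rintro ⟨t, x⟩ h
  exact hf t x fun ht => h ⟨ht, mem_univ _⟩

theorem TimeSupported.integrable {a b : ℝ} {f : ℝ × Torus L → ℝ}
    (hf : TimeSupported a b f) (hc : Continuous f) : Integrable f :=
  hc.integrable_of_hasCompactSupport hf.hasCompactSupport

theorem TimeSupported.exists_bound {a b : ℝ} {f : ℝ × Torus L → ℝ}
    (hf : TimeSupported a b f) (hc : Continuous f) : ∃ K, ∀ z, ‖f z‖ ≤ K :=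
  hc.bounded_above_of_compact_support hf.hasCompactSupport

/-- A spatial derivative has integral zero, since the integral of `f` is translation invariant. -/
theorem SmoothPer.integral_pd_eq_zero {a b : ℝ} {f : ℝ × Torus L → ℝ} (hf : SmoothPer f)
    (hs : TimeSupported a b f) (i : Fin 3) : ∫ z, pd i f z = 0 := by
  obtain ⟨K, hK⟩ := (hs.pd i).exists_bound (hf.continuous_pd i)
  have hK0 : 0 ≤ K := (norm_nonneg _).trans (hK 0)
  have htr : ∀ τ : ℝ, ∫ z : ℝ × Torus L, f (z.1, z.2 + proj L (τ • basisVec i)) = ∫ z, f z := by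
    intro τ
    have := integral_add_right_eq_self (μ := (volume : Measure (ℝ × Torus L))) f
      (0, proj L (τ • basisVec i))
    rw [← this]
    congr 1 with z
    congr 1
    ext <;> simp
  have hcont : ∀ τ : ℝ, Continuous fun z : ℝ × Torus L =>
      (z.1, z.2 + proj L (τ • basisVec i)) := fun τ => by fun_prop
  set S : Set (ℝ × Torus L) := Icc a b ×ˢ univ
  have hScomp : IsCompact S := isCompact_Icc.prod isCompact_univ
  have key := hasDerivAt_integral_of_dominated_loc_of_deriv_le (μ := volume)
    (F := fun (τ : ℝ) (z : ℝ × Torus L) => f (z.1, z.2 + proj L (τ • basisVec i)))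
    (F' := fun (τ : ℝ) (z : ℝ × Torus L) => pd i f (z.1, z.2 + proj L (τ • basisVec i)))
    (x₀ := (0 : ℝ)) (s := univ) (bound := S.indicator fun _ => K) univ_mem
    (Eventually.of_forall fun τ => (hf.continuous.comp (hcont τ)).aestronglyMeasurable)
    (by simpa using hs.integrable hf.continuous)
    ((hf.continuous_pd i).comp (hcont 0)).aestronglyMeasurable
    (by
      refine Eventually.of_forall fun z τ _ => ?_
      by_cases hz : z ∈ S
      · rw [indicator_of_mem hz]
        exact hK _
      · rw [indicator_of_notMem hz, hs.pd i _ _ fun h => hz ⟨h, mem_univ _⟩]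
        simp)
    (by
      rw [integrable_indicator_iff hScomp.measurableSet]
      exact integrableOn_const hScomp.measure_lt_top.ne)
    (Eventually.of_forall fun z τ _ => hf.hasDerivAt_line i z.1 z.2 τ)
  have h1 := key.2
  simp only [htr] at h1
  have h2 := h1.unique (hasDerivAt_const (0 : ℝ) (∫ z, f z))
  simpa using h2

end

section

variable {L : ℝ}

/-! ### The correlations of a weak solution -/

theorem measurableSet_slab (T : ℝ) : MeasurableSet (slab L T) :=
  measurableSet_Ioo.prod MeasurableSet.univ

/-- As a function of the base point `z`, a kernel `η(w - z)` is an admissible test function after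
localization by `ψ`. -/
theorem mem_testFn_mul_kernel {T a b : ℝ} {ψ η : ℝ × Torus L → ℝ} (ha : 0 < a) (hb : b < T)
    (hψ : SmoothPer ψ) (hψs : TimeSupported a b ψ) (hη : SmoothPer η) (w : ℝ × Torus L) :
    (fun z => η (w - z) * ψ z) ∈ TestFn L T :=
  ⟨(hη.comp_const_sub w).mul hψ, a, b, ha, hb, fun t x ht => by simp [hψs t x ht]⟩

/-- As a function of the shifted point `w`, a kernel `η(w - z)` is itself an admissible test
function, provided its support in time is narrower than the distance from `z` to the ends of the
time interval. -/
theorem mem_testFn_kernel {T a b δ : ℝ} {η : ℝ × Torus L → ℝ} (ha : 0 < a - δ) (hb : b + δ < T)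
    (hη : SmoothPer η) (hηs : TimeSupported (-δ) δ η) {z : ℝ × Torus L} (hz : z.1 ∈ Icc a b) :
    (fun w => η (w - z)) ∈ TestFn L T := by
  refine ⟨hη.comp_sub_const z, a - δ, b + δ, ha, hb, fun t x ht => hηs _ _ fun h => ht ?_⟩
  have h1 := h.1
  have h2 := h.2
  simp only at h1 h2
  exact ⟨by linarith [hz.1], by linarith [hz.2]⟩

variable [Fact (0 < L)]

theorem volume_slab_lt_top (T : ℝ) : volume (slab L T) < ⊤ :=
  (measure_mono (Set.prod_mono Ioo_subset_Icc_self subset_rfl)).trans_lt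
    ((isCompact_Icc (a := 0) (b := T)).prod (isCompact_univ (X := Torus L))).measure_lt_top

theorem mixedNorm_indicator_slab {p q : ℝ} (hp : 0 < p) (hq : 0 < q) (T : ℝ)
    (f : ℝ × Torus L → ℝ) :
    mixedNorm p q ((slab L T).indicator f) =
      (∫⁻ t in Ioo 0 T, ((∫⁻ x, ‖f (t, x)‖ₑ ^ q) ^ (1 / q)) ^ p) ^ (1 / p) := by
  unfold mixedNorm
  rw [← lintegral_indicator measurableSet_Ioo]
  congr 2
  ext t
  by_cases ht : t ∈ Ioo 0 T
  · have : ∀ x : Torus L, (t, x) ∈ slab L T := fun x => ⟨ht, mem_univ _⟩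
    simp [indicator_of_mem, this, ht]
  · have : ∀ x : Torus L, (t, x) ∉ slab L T := fun x h => ht h.1
    simp [indicator_of_notMem, this, ht, hp, hq]

/-- The slab has finite measure, so its indicator lies in every mixed space. It serves as a filler
factor in trilinear estimates with fewer than three genuine factors. -/
theorem memMixed_indicator_one {p q : ℝ} (hp : 0 < p) (hq : 0 < q) (T : ℝ) :
    MemMixed p q ((slab L T).indicator fun _ => (1 : ℝ)) := by
  refine ⟨aestronglyMeasurable_const.indicator (measurableSet_slab T), ?_⟩
  rw [mixedNorm_indicator_slab hp hq]
  have h1 : volume (univ : Set (Torus L)) < ⊤ := measure_lt_top _ _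
  refine ENNReal.rpow_lt_top_of_nonneg (by positivity) ?_
  simp only [enorm_one, ENNReal.one_rpow, lintegral_const, Measure.restrict_apply_univ, one_mul]
  refine ENNReal.mul_ne_top (ENNReal.rpow_ne_top_of_nonneg hp.le
    (ENNReal.rpow_ne_top_of_nonneg (by positivity) h1.ne)) (by simp)

/-- A weak solution of the transport equation with divergence-free velocity, extended by zero
outside the slab and with the velocity given by its components. -/
structure TransportSol (T p q m n : ℝ) (θ : ℝ × Torus L → ℝ) (v : Fin 3 → ℝ × Torus L → ℝ) :
    Prop where
  exponents : HolderExponents p q m n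
  mem_scalar : MemMixed p q θ
  mem_velocity : ∀ i, MemMixed m n (v i)
  scalar_off : ∀ z ∉ slab L T, θ z = 0
  velocity_off : ∀ i, ∀ z ∉ slab L T, v i z = 0
  transport : ∀ ψ ∈ TestFn L T,
    ∫ z, (θ z * dt ψ z + ∑ i, θ z * v i z * pd i ψ z) = 0
  div_free : ∀ ψ ∈ TestFn L T, ∫ z, ∑ i, v i z * pd i ψ z = 0

namespace TransportSol

variable {T p q m n : ℝ} {θ : ℝ × Torus L → ℝ} {v : Fin 3 → ℝ × Torus L → ℝ}

theorem integrable_sq_mul (D : TransportSol T p q m n θ v) {c : ℝ × Torus L → ℝ}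
    (hc : MemMixed m n c) : Integrable fun z => θ z ^ 2 * c z := by
  have := integrable_tri D.exponents D.mem_scalar D.mem_scalar hc
    (aestronglyMeasurable_const (b := (1 : ℝ))) (K := 1) (by simp) 0 0 0
  simpa [sq] using this

theorem scalar_mul_indicator (D : TransportSol T p q m n θ v) (z) :
    θ z * (slab L T).indicator (fun _ => (1 : ℝ)) z = θ z := by
  by_cases h : z ∈ slab L T
  · simp [h]
  · simp [h, D.scalar_off z h]

theorem integrable_sq (D : TransportSol T p q m n θ v) : Integrable fun z => θ z ^ 2 := by
  refine (D.integrable_sq_mul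
    (memMixed_indicator_one D.exponents.hm D.exponents.hn T)).congr (Eventually.of_forall ?_)
  intro z
  dsimp only
  rw [sq, mul_assoc, D.scalar_mul_indicator]

theorem integrable_mul (D : TransportSol T p q m n θ v) {c : ℝ × Torus L → ℝ}
    (hc : MemMixed m n c) : Integrable fun z => θ z * c z := by
  have := integrable_tri D.exponents D.mem_scalar
    (memMixed_indicator_one D.exponents.hp D.exponents.hq T) hc
    (aestronglyMeasurable_const (b := (1 : ℝ))) (K := 1) (by simp) 0 0 0
  simpa [D.scalar_mul_indicator] using this

theorem integrable_scalar (D : TransportSol T p q m n θ v) : Integrable θ := by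
  refine (D.integrable_mul
    (memMixed_indicator_one D.exponents.hm D.exponents.hn T)).congr (Eventually.of_forall ?_)
  exact D.scalar_mul_indicator

theorem integrable_of_memMixed (D : TransportSol T p q m n θ v) {c : ℝ × Torus L → ℝ}
    (hc : MemMixed m n c) (hcS : ∀ z ∉ slab L T, c z = 0) : Integrable c := by
  have h1 := memMixed_indicator_one (L := L) D.exponents.hp D.exponents.hq T
  have := integrable_tri D.exponents h1 h1 hc
    (aestronglyMeasurable_const (b := (1 : ℝ))) (K := 1) (by simp) 0 0 0
  refine this.congr (Eventually.of_forall fun z => ?_)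
  by_cases h : z ∈ slab L T
  · simp [h]
  · simp [hcS z h]

theorem integrable_velocity (D : TransportSol T p q m n θ v) (i : Fin 3) : Integrable (v i) :=
  D.integrable_of_memMixed (D.mem_velocity i) (D.velocity_off i)

/-- A product `α(z) β(z + h)` that splits as a trilinear expression in `θ`, `θ` and `c` with shifts
depending continuously on `h` forms a `CorrPair`. -/
theorem corrPair_of_tri (D : TransportSol T p q m n θ v) {c χ α β : ℝ × Torus L → ℝ}
    (hc : MemMixed m n c) (hcS : ∀ z ∉ slab L T, c z = 0)
    (hχ : AEStronglyMeasurable χ volume) {K : ℝ} (hχK : ∀ z, ‖χ z‖ ≤ K)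
    (hα : Integrable α) (hβ : Integrable β) {Y₁ Y₂ Y₃ : ℝ × Torus L → ℝ × Torus L}
    (h₁ : Continuous Y₁) (h₂ : Continuous Y₂) (h₃ : Continuous Y₃)
    (h : ∀ z h, θ (z + Y₁ h) * θ (z + Y₂ h) * c (z + Y₃ h) * χ z = α z * β (z + h)) :
    CorrPair α β := by
  refine ⟨hα, hβ, ⟨mixedNorm p q θ * mixedNorm p q θ * mixedNorm m n c * ENNReal.ofReal K,
    ?_, fun h' => ?_⟩, ?_⟩
  · exact ENNReal.mul_lt_top (ENNReal.mul_lt_top (ENNReal.mul_lt_top D.mem_scalar.2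
      D.mem_scalar.2) hc.2) ENNReal.ofReal_lt_top
  · have := lintegral_tri_le D.exponents D.mem_scalar.1 D.mem_scalar.1 hc.1 hχK
      (Y₁ h') (Y₂ h') (Y₃ h')
    simpa only [h] using this
  · have : corr α β = tri θ θ c χ ∘ fun h => (Y₁ h, Y₂ h, Y₃ h) := by
      ext h'
      simp only [corr, tri, Function.comp, h]
    rw [this]
    exact (continuous_tri D.exponents (volume_slab_lt_top T) D.mem_scalar D.mem_scalar hc
      D.scalar_off D.scalar_off hcS hχ hχK).comp (h₁.prodMk (h₂.prodMk h₃))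

section Pairs

variable {χ : ℝ × Torus L → ℝ} {K : ℝ}

theorem integrable_bdd_mul {f : ℝ × Torus L → ℝ} (hχ : Continuous χ) (hχK : ∀ z, ‖χ z‖ ≤ K)
    (hf : Integrable f) : Integrable fun z => χ z * f z :=
  hf.bdd_mul hχ.aestronglyMeasurable (Eventually.of_forall hχK)

theorem corrPair_sq_flux (D : TransportSol T p q m n θ v) (hχ : Continuous χ)
    (hχK : ∀ z, ‖χ z‖ ≤ K) (hχi : Integrable χ) (i : Fin 3) :
    CorrPair χ fun z => θ z ^ 2 * v i z :=
  D.corrPair_of_tri (D.mem_velocity i) (D.velocity_off i) hχ.aestronglyMeasurable hχK hχi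
    (D.integrable_sq_mul (D.mem_velocity i)) continuous_id continuous_id continuous_id
    fun z h => by simp only [id]; ring

theorem corrPair_scalar_flux (D : TransportSol T p q m n θ v) (hχ : Continuous χ)
    (hχK : ∀ z, ‖χ z‖ ≤ K) (i : Fin 3) :
    CorrPair (fun z => χ z * θ z) fun z => θ z * v i z :=
  D.corrPair_of_tri (D.mem_velocity i) (D.velocity_off i) hχ.aestronglyMeasurable hχK
    (integrable_bdd_mul hχ hχK D.integrable_scalar)
    (D.integrable_mul (D.mem_velocity i)) (continuous_const (y := 0)) continuous_id continuous_id
    fun z h => by simp only [id, add_zero]; ring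

theorem corrPair_sq_velocity (D : TransportSol T p q m n θ v) (hχ : Continuous χ)
    (hχK : ∀ z, ‖χ z‖ ≤ K) (i : Fin 3) :
    CorrPair (fun z => χ z * θ z ^ 2) (v i) :=
  D.corrPair_of_tri (D.mem_velocity i) (D.velocity_off i) hχ.aestronglyMeasurable hχK
    (integrable_bdd_mul hχ hχK D.integrable_sq)
    (D.integrable_velocity i) (continuous_const (y := 0)) (continuous_const (y := 0)) continuous_id
    fun z h => by simp only [id, add_zero]; ring

theorem corrPair_velocity_sq (D : TransportSol T p q m n θ v) (hχ : Continuous χ)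
    (hχK : ∀ z, ‖χ z‖ ≤ K) (i : Fin 3) :
    CorrPair (fun z => χ z * v i z) fun z => θ z ^ 2 :=
  D.corrPair_of_tri (D.mem_velocity i) (D.velocity_off i) hχ.aestronglyMeasurable hχK
    (integrable_bdd_mul hχ hχK (D.integrable_velocity i))
    D.integrable_sq continuous_id continuous_id (continuous_const (y := 0))
    fun z h => by simp only [id, add_zero]; ring

theorem corrPair_flux_scalar (D : TransportSol T p q m n θ v) (hχ : Continuous χ)
    (hχK : ∀ z, ‖χ z‖ ≤ K) (i : Fin 3) :
    CorrPair (fun z => χ z * (θ z * v i z)) θ :=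
  D.corrPair_of_tri (D.mem_velocity i) (D.velocity_off i) hχ.aestronglyMeasurable hχK
    (integrable_bdd_mul hχ hχK (D.integrable_mul (D.mem_velocity i)))
    D.integrable_scalar (continuous_const (y := 0)) continuous_id (continuous_const (y := 0))
    fun z h => by simp only [id, add_zero]; ring

theorem corrPair_scalar_scalar (D : TransportSol T p q m n θ v) (hχ : Continuous χ)
    (hχK : ∀ z, ‖χ z‖ ≤ K) : CorrPair (fun z => χ z * θ z) θ := by
  refine D.corrPair_of_tri (memMixed_indicator_one D.exponents.hm D.exponents.hn T)
    (fun z hz => indicator_of_notMem hz _) hχ.aestronglyMeasurable hχK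
    (integrable_bdd_mul hχ hχK D.integrable_scalar)
    D.integrable_scalar (continuous_const (y := 0)) continuous_id (continuous_const (y := 0))
    fun z h => ?_
  simp only [id, add_zero]
  rw [mul_right_comm (θ z), D.scalar_mul_indicator]
  ring

end Pairs

/-! ### The equations tested against a kernel -/

section Kernel

variable {ψ η : ℝ × Torus L → ℝ} {a b δ : ℝ}

/-- A bounded continuous kernel may be integrated against any integrable function. -/
theorem integrable_kernel_mul {κ f : ℝ × Torus L → ℝ} (hκ : Continuous κ)
    (hκs : TimeSupported (-δ) δ κ) (hf : Integrable f) (w : ℝ × Torus L) :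
    Integrable fun z => κ (w - z) * f z := by
  obtain ⟨K, hK⟩ := hκs.exists_bound hκ
  exact hf.bdd_mul (hκ.comp (by fun_prop : Continuous fun z => w - z)).aestronglyMeasurable
    (Eventually.of_forall fun z => hK _)

theorem integrable_kernel_mul' {κ f : ℝ × Torus L → ℝ} (hκ : Continuous κ)
    (hκs : TimeSupported (-δ) δ κ) (hf : Integrable f) (z : ℝ × Torus L) :
    Integrable fun w => κ (w - z) * f w := by
  obtain ⟨K, hK⟩ := hκs.exists_bound hκ
  exact hf.bdd_mul (hκ.comp (by fun_prop : Continuous fun w => w - z)).aestronglyMeasurable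
    (Eventually.of_forall fun z => hK _)

variable (ha : 0 < a) (hb : b < T) (hψ : SmoothPer ψ) (hψs : TimeSupported a b ψ)
  (hη : SmoothPer η) (hηs : TimeSupported (-δ) δ η)

include ha hb hψ hψs hη hηs

/-- Incompressibility in the base point `z`, tested against `η(w - z) ψ(z)`. -/
theorem sum_integral_pd_kernel_velocity (D : TransportSol T p q m n θ v) (w : ℝ × Torus L) :
    ∑ i, ∫ z, pd i η (w - z) * (ψ z * v i z) = ∑ i, ∫ z, η (w - z) * (pd i ψ z * v i z) := by
  obtain ⟨K, hK⟩ := hψs.exists_bound hψ.continuous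
  have h := D.div_free _ (mem_testFn_mul_kernel ha hb hψ hψs hη w)
  simp only [(hη.comp_const_sub w).pd_mul hψ, hη.pd_comp_const_sub] at h
  have i1 : ∀ i, Integrable fun z => pd i η (w - z) * (ψ z * v i z) := fun i =>
    integrable_kernel_mul (hη.continuous_pd i) (hηs.pd i)
      (integrable_bdd_mul hψ.continuous hK (D.integrable_velocity i)) w
  have i2 : ∀ i, Integrable fun z => η (w - z) * (pd i ψ z * v i z) := fun i => by
    obtain ⟨K', hK'⟩ := (hψs.pd i).exists_bound (hψ.continuous_pd i)
    exact integrable_kernel_mul hη.continuous hηs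
      (integrable_bdd_mul (hψ.continuous_pd i) hK' (D.integrable_velocity i)) w
  have h2 : ∀ z, ∑ i, v i z * (-pd i η (w - z) * ψ z + η (w - z) * pd i ψ z)
      = ∑ i, (η (w - z) * (pd i ψ z * v i z) - pd i η (w - z) * (ψ z * v i z)) := fun z =>
    Finset.sum_congr rfl fun i _ => by ring
  have i12 : ∀ i, Integrable fun z =>
      η (w - z) * (pd i ψ z * v i z) - pd i η (w - z) * (ψ z * v i z) := fun i =>
    (i2 i).sub (i1 i)
  simp_rw [h2] at h
  rw [integral_finsetSum _ fun i _ => i12 i] at h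
  simp_rw [integral_sub (i2 _) (i1 _)] at h
  rw [Finset.sum_sub_distrib] at h
  linarith

/-- The transport equation in the base point `z`, tested against `η(w - z) ψ(z)`. -/
theorem sum_integral_pd_kernel_flux (D : TransportSol T p q m n θ v) (w : ℝ × Torus L) :
    ∑ i, ∫ z, pd i η (w - z) * (ψ z * (θ z * v i z)) =
      (∑ i, ∫ z, η (w - z) * (pd i ψ z * (θ z * v i z)))
      + (∫ z, η (w - z) * (dt ψ z * θ z)) - ∫ z, dt η (w - z) * (ψ z * θ z) := by
  obtain ⟨K, hK⟩ := hψs.exists_bound hψ.continuous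
  obtain ⟨Kt, hKt⟩ := hψs.dt.exists_bound hψ.continuous_dt
  have h := D.transport _ (mem_testFn_mul_kernel ha hb hψ hψs hη w)
  simp only [(hη.comp_const_sub w).pd_mul hψ, (hη.comp_const_sub w).dt_mul hψ,
    hη.dt_comp_const_sub, hη.pd_comp_const_sub] at h
  have i1 : ∀ i, Integrable fun z => pd i η (w - z) * (ψ z * (θ z * v i z)) := fun i =>
    integrable_kernel_mul (hη.continuous_pd i) (hηs.pd i)
      (integrable_bdd_mul hψ.continuous hK (D.integrable_mul (D.mem_velocity i))) w
  have i2 : ∀ i, Integrable fun z => η (w - z) * (pd i ψ z * (θ z * v i z)) := fun i => by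
    obtain ⟨K', hK'⟩ := (hψs.pd i).exists_bound (hψ.continuous_pd i)
    exact integrable_kernel_mul hη.continuous hηs
      (integrable_bdd_mul (hψ.continuous_pd i) hK' (D.integrable_mul (D.mem_velocity i))) w
  have i3 : Integrable fun z => η (w - z) * (dt ψ z * θ z) :=
    integrable_kernel_mul hη.continuous hηs
      (integrable_bdd_mul hψ.continuous_dt hKt D.integrable_scalar) w
  have i4 : Integrable fun z => dt η (w - z) * (ψ z * θ z) :=
    integrable_kernel_mul hη.continuous_dt hηs.dt
      (integrable_bdd_mul hψ.continuous hK D.integrable_scalar) w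
  have h2 : ∀ z, θ z * (-dt η (w - z) * ψ z + η (w - z) * dt ψ z)
      + ∑ i, θ z * v i z * (-pd i η (w - z) * ψ z + η (w - z) * pd i ψ z)
      = (η (w - z) * (dt ψ z * θ z) - dt η (w - z) * (ψ z * θ z))
        + ∑ i, (η (w - z) * (pd i ψ z * (θ z * v i z))
          - pd i η (w - z) * (ψ z * (θ z * v i z))) := fun z => by
    congr 1
    · ring
    · exact Finset.sum_congr rfl fun i _ => by ring
  have i12 : ∀ i, Integrable fun z => η (w - z) * (pd i ψ z * (θ z * v i z))
      - pd i η (w - z) * (ψ z * (θ z * v i z)) := fun i => (i2 i).sub (i1 i)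
  have i34 : Integrable fun z => η (w - z) * (dt ψ z * θ z) - dt η (w - z) * (ψ z * θ z) :=
    i3.sub i4
  simp_rw [h2] at h
  rw [integral_add i34 (integrable_finsetSum _ fun i _ => i12 i),
    integral_finsetSum _ fun i _ => i12 i, integral_sub i3 i4] at h
  simp_rw [integral_sub (i2 _) (i1 _)] at h
  rw [Finset.sum_sub_distrib] at h
  linarith

omit ha hb hψ hψs in
/-- Incompressibility in the shifted point `w`, tested against `η(w - z)`. -/
theorem sum_integral_pd_kernel_velocity_eq_zero (ha' : 0 < a - δ) (hb' : b + δ < T)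
    (D : TransportSol T p q m n θ v) {z : ℝ × Torus L} (hz : z.1 ∈ Icc a b) :
    ∑ i, ∫ w, pd i η (w - z) * v i w = 0 := by
  have h := D.div_free _ (mem_testFn_kernel ha' hb' hη hηs hz)
  simp only [pd_comp_sub_const] at h
  rw [integral_finsetSum _ fun i _ => by
    simpa only [mul_comm] using
      integrable_kernel_mul' (hη.continuous_pd i) (hηs.pd i) (D.integrable_velocity i) z] at h
  simpa only [mul_comm] using h

omit ha hb hψ hψs in
/-- The transport equation in the shifted point `w`, tested against `η(w - z)`. -/
theorem sum_integral_pd_kernel_flux_eq (ha' : 0 < a - δ) (hb' : b + δ < T)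
    (D : TransportSol T p q m n θ v) {z : ℝ × Torus L} (hz : z.1 ∈ Icc a b) :
    ∑ i, ∫ w, pd i η (w - z) * (θ w * v i w) = -∫ w, dt η (w - z) * θ w := by
  have h := D.transport _ (mem_testFn_kernel ha' hb' hη hηs hz)
  simp only [pd_comp_sub_const, dt_comp_sub_const] at h
  have i1 : ∀ i, Integrable fun w => θ w * v i w * pd i η (w - z) := fun i => by
    simpa only [mul_comm] using integrable_kernel_mul' (hη.continuous_pd i) (hηs.pd i)
      (D.integrable_mul (D.mem_velocity i)) z
  have i2 : Integrable fun w => θ w * dt η (w - z) := by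
    simpa only [mul_comm] using integrable_kernel_mul' hη.continuous_dt hηs.dt
      D.integrable_scalar z
  rw [integral_add i2 (integrable_finsetSum _ fun i _ => i1 i),
    integral_finsetSum _ fun i _ => i1 i] at h
  have e1 : ∀ i, ∫ w, pd i η (w - z) * (θ w * v i w) = ∫ w, θ w * v i w * pd i η (w - z) :=
    fun i => by congr 1 with w; ring
  have e2 : ∫ w, dt η (w - z) * θ w = ∫ w, θ w * dt η (w - z) := by congr 1 with w; ring
  rw [e2]
  simp_rw [e1]
  linarith

end Kernel

end TransportSol

end

section

theorem _root_.MeasureTheory.Integrable.fun_sub {α : Type*} [MeasurableSpace α] {μ : Measure α}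
    {f g : α → ℝ} (hf : Integrable f μ) (hg : Integrable g μ) :
    Integrable (fun x => f x - g x) μ :=
  hf.sub hg

variable {L : ℝ} [Fact (0 < L)]

/-! ### The divergence of the third-order structure function -/

/-- The `i`-th component of `h ↦ ∫ ψ(z) (v(z + h) - v(z)) (θ(z + h) - θ(z))² dz`, expanded into
correlations. -/
def flux (θ : ℝ × Torus L → ℝ) (v : Fin 3 → ℝ × Torus L → ℝ) (ψ : ℝ × Torus L → ℝ)
    (i : Fin 3) (h : ℝ × Torus L) : ℝ :=
  corr ψ (fun z => θ z ^ 2 * v i z) h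
    - 2 * corr (fun z => ψ z * θ z) (fun z => θ z * v i z) h
    + corr (fun z => ψ z * θ z ^ 2) (v i) h
    - corr (fun z => ψ z * v i z) (fun z => θ z ^ 2) h
    + 2 * corr (fun z => ψ z * (θ z * v i z)) θ h
    - ∫ z, ψ z * (θ z ^ 2 * v i z)

/-- The divergence of `flux` with respect to the spatial increment. -/
def fluxDiv (θ : ℝ × Torus L → ℝ) (v : Fin 3 → ℝ × Torus L → ℝ) (ψ : ℝ × Torus L → ℝ)
    (h : ℝ × Torus L) : ℝ :=
  (∑ i, (corr (fun z => pd i ψ z * v i z) (fun z => θ z ^ 2) h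
    - corr (pd i ψ) (fun z => θ z ^ 2 * v i z) h
    - 2 * corr (fun z => pd i ψ z * (θ z * v i z)) θ h))
    - 2 * corr (fun z => dt ψ z * θ z) θ h

namespace TransportSol

variable {T p q m n : ℝ} {θ : ℝ × Torus L → ℝ} {v : Fin 3 → ℝ × Torus L → ℝ}
  {ψ η : ℝ × Torus L → ℝ} {a b δ : ℝ}

theorem continuous_flux (D : TransportSol T p q m n θ v) (hψ : SmoothPer ψ)
    (hψs : TimeSupported a b ψ) (i : Fin 3) : Continuous (flux θ v ψ i) := by
  obtain ⟨K, hK⟩ := hψs.exists_bound hψ.continuous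
  have c1 := (D.corrPair_sq_flux hψ.continuous hK (hψs.integrable hψ.continuous) i).continuous_corr
  have c2 := (D.corrPair_scalar_flux hψ.continuous hK i).continuous_corr
  have c3 := (D.corrPair_sq_velocity hψ.continuous hK i).continuous_corr
  have c4 := (D.corrPair_velocity_sq hψ.continuous hK i).continuous_corr
  have c5 := (D.corrPair_flux_scalar hψ.continuous hK i).continuous_corr
  unfold flux
  fun_prop

theorem continuous_fluxDiv (D : TransportSol T p q m n θ v) (hψ : SmoothPer ψ)
    (hψs : TimeSupported a b ψ) : Continuous (fluxDiv θ v ψ) := by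
  obtain ⟨Kt, hKt⟩ := hψs.dt.exists_bound hψ.continuous_dt
  have ct := (D.corrPair_scalar_scalar hψ.continuous_dt hKt).continuous_corr
  have c : ∀ i, Continuous fun h => (corr (fun z => pd i ψ z * v i z) (fun z => θ z ^ 2) h
    - corr (pd i ψ) (fun z => θ z ^ 2 * v i z) h
    - 2 * corr (fun z => pd i ψ z * (θ z * v i z)) θ h) := by
    intro i
    obtain ⟨K, hK⟩ := (hψs.pd i).exists_bound (hψ.continuous_pd i)
    have c1 := (D.corrPair_sq_flux (hψ.continuous_pd i) hK
      ((hψs.pd i).integrable (hψ.continuous_pd i)) i).continuous_corr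
    have c4 := (D.corrPair_velocity_sq (hψ.continuous_pd i) hK i).continuous_corr
    have c5 := (D.corrPair_flux_scalar (hψ.continuous_pd i) hK i).continuous_corr
    fun_prop
  unfold fluxDiv
  fun_prop

theorem integrable_kernel_mul_continuous {κ f : ℝ × Torus L → ℝ} (hκ : Continuous κ)
    (hκs : TimeSupported (-δ) δ κ) (hf : Continuous f) : Integrable fun h => κ h * f h :=
  (hκ.mul hf).integrable_of_hasCompactSupport (hκs.hasCompactSupport.mul_right)

section Kernel

variable (ha : 0 < a) (hb : b < T) (hψ : SmoothPer ψ) (hψs : TimeSupported a b ψ)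
  (hη : SmoothPer η) (hηs : TimeSupported (-δ) δ η)

include hψ hψs hη hηs

/-- Here no equation is needed: the increment derivative is moved onto `ψ` by integration by parts. -/
theorem integral_pd_mul_corr_sq_flux (D : TransportSol T p q m n θ v) (i : Fin 3) :
    ∫ h, pd i η h * corr ψ (fun z => θ z ^ 2 * v i z) h
      = ∫ h, η h * corr (pd i ψ) (fun z => θ z ^ 2 * v i z) h := by
  obtain ⟨K, hK⟩ := hψs.exists_bound hψ.continuous
  obtain ⟨K', hK'⟩ := (hψs.pd i).exists_bound (hψ.continuous_pd i)
  have P := D.corrPair_sq_flux hψ.continuous hK (hψs.integrable hψ.continuous) i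
  have P' := D.corrPair_sq_flux (hψ.continuous_pd i) hK'
    ((hψs.pd i).integrable (hψ.continuous_pd i)) i
  rw [P.integral_mul_corr_left ((hηs.pd i).integrable (hη.continuous_pd i)),
    P'.integral_mul_corr_left (hηs.integrable hη.continuous)]
  congr 1 with w
  congr 1
  have hs : TimeSupported a b fun z => η (w - z) * ψ z := fun t x ht => by simp [hψs t x ht]
  have h := ((hη.comp_const_sub w).mul hψ).integral_pd_eq_zero hs i
  simp only [(hη.comp_const_sub w).pd_mul hψ, hη.pd_comp_const_sub] at h
  have i1 := integrable_kernel_mul (hη.continuous_pd i) (hηs.pd i)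
    (hψs.integrable hψ.continuous) w
  have i2 := integrable_kernel_mul hη.continuous hηs
    ((hψs.pd i).integrable (hψ.continuous_pd i)) w
  have e : ∀ z, -pd i η (w - z) * ψ z + η (w - z) * pd i ψ z
      = η (w - z) * pd i ψ z - pd i η (w - z) * ψ z := fun z => by ring
  simp_rw [e] at h
  rw [integral_sub i2 i1] at h
  linarith

/-- The transport equation at the shifted point `z + h`. -/
theorem sum_integral_pd_mul_corr_scalar_flux (ha' : 0 < a - δ) (hb' : b + δ < T)
    (D : TransportSol T p q m n θ v) :
    ∑ i, ∫ h, pd i η h * corr (fun z => ψ z * θ z) (fun z => θ z * v i z) h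
      = -∫ h, dt η h * corr (fun z => ψ z * θ z) θ h := by
  obtain ⟨K, hK⟩ := hψs.exists_bound hψ.continuous
  have P := fun i => D.corrPair_scalar_flux hψ.continuous hK i
  have hi := fun i => (hηs.pd i).integrable (hη.continuous_pd i)
  rw [(D.corrPair_scalar_scalar hψ.continuous hK).integral_mul_corr_right
    (hηs.dt.integrable hη.continuous_dt)]
  simp_rw [(P _).integral_mul_corr_right (hi _)]
  rw [← integral_finsetSum _ fun i _ => (P i).integrable_integral_right (hi i), ← integral_neg]
  congr 1 with z
  rw [← Finset.mul_sum, ← mul_neg]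
  by_cases hz : z.1 ∈ Icc a b
  · rw [sum_integral_pd_kernel_flux_eq hη hηs ha' hb' D hz]
  · rw [show ψ z = 0 from hψs z.1 z.2 hz]
    simp

/-- Incompressibility at the shifted point `z + h`. -/
theorem sum_integral_pd_mul_corr_sq_velocity (ha' : 0 < a - δ) (hb' : b + δ < T)
    (D : TransportSol T p q m n θ v) :
    ∑ i, ∫ h, pd i η h * corr (fun z => ψ z * θ z ^ 2) (v i) h = 0 := by
  obtain ⟨K, hK⟩ := hψs.exists_bound hψ.continuous
  have P := fun i => D.corrPair_sq_velocity hψ.continuous hK i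
  have hi := fun i => (hηs.pd i).integrable (hη.continuous_pd i)
  simp_rw [(P _).integral_mul_corr_right (hi _)]
  rw [← integral_finsetSum _ fun i _ => (P i).integrable_integral_right (hi i)]
  refine integral_eq_zero_of_ae (Eventually.of_forall fun z => ?_)
  dsimp only
  rw [← Finset.mul_sum]
  by_cases hz : z.1 ∈ Icc a b
  · rw [sum_integral_pd_kernel_velocity_eq_zero hη hηs ha' hb' D hz]
    simp
  · rw [show ψ z = 0 from hψs z.1 z.2 hz]
    simp

include ha hb

/-- Incompressibility at the base point `z`. -/
theorem sum_integral_pd_mul_corr_velocity_sq (D : TransportSol T p q m n θ v) :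
    ∑ i, ∫ h, pd i η h * corr (fun z => ψ z * v i z) (fun z => θ z ^ 2) h
      = ∑ i, ∫ h, η h * corr (fun z => pd i ψ z * v i z) (fun z => θ z ^ 2) h := by
  obtain ⟨K, hK⟩ := hψs.exists_bound hψ.continuous
  choose K' hK' using fun i => (hψs.pd i).exists_bound (hψ.continuous_pd i)
  have P := fun i => D.corrPair_velocity_sq hψ.continuous hK i
  have P' := fun i => D.corrPair_velocity_sq (hψ.continuous_pd i) (hK' i) i
  have hi := fun i => (hηs.pd i).integrable (hη.continuous_pd i)
  have hi' := hηs.integrable hη.continuous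
  simp_rw [(P _).integral_mul_corr_left (hi _), (P' _).integral_mul_corr_left hi']
  rw [← integral_finsetSum _ fun i _ => (P i).integrable_integral_left (hi i),
    ← integral_finsetSum _ fun i _ => (P' i).integrable_integral_left hi']
  congr 1 with w
  rw [← Finset.mul_sum, ← Finset.mul_sum,
    sum_integral_pd_kernel_velocity ha hb hψ hψs hη hηs D w]

/-- The transport equation at the base point `z`. The term in `∂ₜη` is the opposite of the one in
`sum_integral_pd_mul_corr_scalar_flux`, so that the two cancel in `flux`. -/
theorem sum_integral_pd_mul_corr_flux_scalar (D : TransportSol T p q m n θ v) :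
    ∑ i, ∫ h, pd i η h * corr (fun z => ψ z * (θ z * v i z)) θ h
      = (∑ i, ∫ h, η h * corr (fun z => pd i ψ z * (θ z * v i z)) θ h)
        + (∫ h, η h * corr (fun z => dt ψ z * θ z) θ h)
        - ∫ h, dt η h * corr (fun z => ψ z * θ z) θ h := by
  obtain ⟨K, hK⟩ := hψs.exists_bound hψ.continuous
  obtain ⟨Kt, hKt⟩ := hψs.dt.exists_bound hψ.continuous_dt
  choose K' hK' using fun i => (hψs.pd i).exists_bound (hψ.continuous_pd i)
  have P := fun i => D.corrPair_flux_scalar hψ.continuous hK i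
  have P' := fun i => D.corrPair_flux_scalar (hψ.continuous_pd i) (hK' i) i
  have Q := D.corrPair_scalar_scalar hψ.continuous hK
  have Q' := D.corrPair_scalar_scalar hψ.continuous_dt hKt
  have hi := fun i => (hηs.pd i).integrable (hη.continuous_pd i)
  have hi' := hηs.integrable hη.continuous
  have hit := hηs.dt.integrable hη.continuous_dt
  simp_rw [(P _).integral_mul_corr_left (hi _), (P' _).integral_mul_corr_left hi']
  have j1 := integrable_finsetSum Finset.univ fun i _ => (P' i).integrable_integral_left hi'
  have j2 := Q'.integrable_integral_left hi'
  have j3 := Q.integrable_integral_left hit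
  rw [Q.integral_mul_corr_left hit, Q'.integral_mul_corr_left hi',
    ← integral_finsetSum _ fun i _ => (P i).integrable_integral_left (hi i),
    ← integral_finsetSum _ fun i _ => (P' i).integrable_integral_left hi',
    ← integral_add j1 j2, ← integral_sub (j1.fun_add j2) j3]
  congr 1 with w
  rw [← Finset.mul_sum, ← Finset.mul_sum, sum_integral_pd_kernel_flux ha hb hψ hψs hη hηs D w]
  ring

/-- In the sense of distributions in the increment, `fluxDiv` is the divergence of `flux`. The
kernel `η` has to be narrow in time, so that the shifted points stay in `(0, T)`. -/
theorem sum_integral_pd_mul_flux (ha' : 0 < a - δ) (hb' : b + δ < T)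
    (D : TransportSol T p q m n θ v) :
    ∑ i, ∫ h, pd i η h * flux θ v ψ i h = -∫ h, η h * fluxDiv θ v ψ h := by
  obtain ⟨K, hK⟩ := hψs.exists_bound hψ.continuous
  obtain ⟨Kt, hKt⟩ := hψs.dt.exists_bound hψ.continuous_dt
  choose K' hK' using fun i => (hψs.pd i).exists_bound (hψ.continuous_pd i)
  have hF : ∀ i, ∫ h, pd i η h * flux θ v ψ i h =
      (∫ h, pd i η h * corr ψ (fun z => θ z ^ 2 * v i z) h)
      - 2 * (∫ h, pd i η h * corr (fun z => ψ z * θ z) (fun z => θ z * v i z) h)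
      + (∫ h, pd i η h * corr (fun z => ψ z * θ z ^ 2) (v i) h)
      - (∫ h, pd i η h * corr (fun z => ψ z * v i z) (fun z => θ z ^ 2) h)
      + 2 * (∫ h, pd i η h * corr (fun z => ψ z * (θ z * v i z)) θ h) := by
    intro i
    have I : ∀ {f : ℝ × Torus L → ℝ}, Continuous f → Integrable fun h => pd i η h * f h :=
      fun hf => integrable_kernel_mul_continuous (hη.continuous_pd i) (hηs.pd i) hf
    have i1 := I (D.corrPair_sq_flux hψ.continuous hK
      (hψs.integrable hψ.continuous) i).continuous_corr
    have i2 := (I (D.corrPair_scalar_flux hψ.continuous hK i).continuous_corr).const_mul 2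
    have i3 := I (D.corrPair_sq_velocity hψ.continuous hK i).continuous_corr
    have i4 := I (D.corrPair_velocity_sq hψ.continuous hK i).continuous_corr
    have i5 := (I (D.corrPair_flux_scalar hψ.continuous hK i).continuous_corr).const_mul 2
    have i6 := (I (f := fun _ => ∫ z, ψ z * (θ z ^ 2 * v i z)) continuous_const)
    -- the constant term of `flux` disappears because `∂ᵢη` has integral zero
    have h6 : ∫ h, pd i η h * (∫ z, ψ z * (θ z ^ 2 * v i z)) = 0 := by
      rw [integral_mul_const, hη.integral_pd_eq_zero hηs, zero_mul]
    rw [← integral_const_mul, ← integral_const_mul, ← integral_sub i1 i2,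
      ← integral_add (i1.fun_sub i2) i3, ← integral_sub ((i1.fun_sub i2).fun_add i3) i4,
      ← integral_add (((i1.fun_sub i2).fun_add i3).fun_sub i4) i5]
    refine Eq.trans ?_ (sub_zero _)
    rw [← h6, ← integral_sub ((((i1.fun_sub i2).fun_add i3).fun_sub i4).fun_add i5) i6]
    congr 1 with h
    simp only [flux]
    ring
  have hG : ∫ h, η h * fluxDiv θ v ψ h =
      (∑ i, ((∫ h, η h * corr (fun z => pd i ψ z * v i z) (fun z => θ z ^ 2) h)
        - (∫ h, η h * corr (pd i ψ) (fun z => θ z ^ 2 * v i z) h)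
        - 2 * (∫ h, η h * corr (fun z => pd i ψ z * (θ z * v i z)) θ h)))
      - 2 * ∫ h, η h * corr (fun z => dt ψ z * θ z) θ h := by
    have I : ∀ {f : ℝ × Torus L → ℝ}, Continuous f → Integrable fun h => η h * f h :=
      fun hf => integrable_kernel_mul_continuous hη.continuous hηs hf
    have i1 := fun i => I (D.corrPair_velocity_sq (hψ.continuous_pd i) (hK' i) i).continuous_corr
    have i2 := fun i => I (D.corrPair_sq_flux (hψ.continuous_pd i) (hK' i)
      ((hψs.pd i).integrable (hψ.continuous_pd i)) i).continuous_corr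
    have i3 := fun i => (I (D.corrPair_flux_scalar (hψ.continuous_pd i) (hK' i)
      i).continuous_corr).const_mul 2
    have i4 := (I (D.corrPair_scalar_scalar hψ.continuous_dt hKt).continuous_corr).const_mul 2
    have i123 := integrable_finsetSum Finset.univ fun i _ => ((i1 i).fun_sub (i2 i)).fun_sub (i3 i)
    rw [← integral_const_mul]
    simp_rw [← integral_const_mul]
    have e : ∀ i, (∫ h, η h * corr (fun z => pd i ψ z * v i z) (fun z => θ z ^ 2) h)
        - (∫ h, η h * corr (pd i ψ) (fun z => θ z ^ 2 * v i z) h)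
        - (∫ h, 2 * (η h * corr (fun z => pd i ψ z * (θ z * v i z)) θ h))
        = ∫ h, ((η h * corr (fun z => pd i ψ z * v i z) (fun z => θ z ^ 2) h)
        - (η h * corr (pd i ψ) (fun z => θ z ^ 2 * v i z) h)
        - (2 * (η h * corr (fun z => pd i ψ z * (θ z * v i z)) θ h))) := fun i => by
      rw [← integral_sub (i1 i) (i2 i), ← integral_sub ((i1 i).fun_sub (i2 i)) (i3 i)]
    simp_rw [e]
    rw [← integral_finsetSum _ fun i _ => ((i1 i).fun_sub (i2 i)).fun_sub (i3 i),
      ← integral_sub i123 i4]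
    congr 1 with h
    simp only [fluxDiv, mul_sub, Finset.mul_sum]
    congr 1
    · refine Finset.sum_congr rfl fun i _ => ?_
      ring
    · ring
  simp_rw [hF]
  rw [hG]
  have t1 := fun i => integral_pd_mul_corr_sq_flux hψ hψs hη hηs D i
  have t2 := sum_integral_pd_mul_corr_scalar_flux hψ hψs hη hηs ha' hb' D
  have t3 := sum_integral_pd_mul_corr_sq_velocity hψ hψs hη hηs ha' hb' D
  have t4 := sum_integral_pd_mul_corr_velocity_sq ha hb hψ hψs hη hηs D
  have t5 := sum_integral_pd_mul_corr_flux_scalar ha hb hψ hψs hη hηs D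
  simp only [Finset.sum_add_distrib, Finset.sum_sub_distrib, ← Finset.mul_sum, t1]
  linarith

end Kernel

end TransportSol

end

section

variable {L : ℝ}

/-! ### Peak kernels and the divergence identity on `ℝ³` -/

/-- The function `cos (2π y / L)` on the circle `ℝ / Lℤ`. -/
def circleCos (y : AddCircle L) : ℝ := (AddCircle.toCircle y : ℂ).re

theorem circleCos_mk (r : ℝ) : circleCos (r : AddCircle L) = Real.cos (2 * Real.pi / L * r) := by
  rw [circleCos, AddCircle.toCircle_apply_mk, Circle.coe_exp]
  rw [Complex.exp_ofReal_mul_I_re]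

theorem circleCos_zero : circleCos (0 : AddCircle L) = 1 := by
  simp [circleCos]

theorem neg_one_le_circleCos (y : AddCircle L) : -1 ≤ circleCos y := by
  have h := Complex.abs_re_le_norm (AddCircle.toCircle y : ℂ)
  rw [Circle.norm_coe] at h
  exact (abs_le.1 h).1

theorem circleCos_le_one (y : AddCircle L) : circleCos y ≤ 1 := by
  have h := Complex.abs_re_le_norm (AddCircle.toCircle y : ℂ)
  rw [Circle.norm_coe] at h
  exact (abs_le.1 h).2

theorem circleCos_lt_one [Fact (0 < L)] {y : AddCircle L} (hy : y ≠ 0) : circleCos y < 1 := by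
  refine lt_of_le_of_ne (circleCos_le_one y) fun h => hy ?_
  apply AddCircle.injective_toCircle (Fact.out : 0 < L).ne'
  rw [AddCircle.toCircle_zero]
  ext
  have h1 : ‖(AddCircle.toCircle y : ℂ)‖ = 1 := Circle.norm_coe _
  have h2 := Complex.sq_norm_sub_sq_re (AddCircle.toCircle y : ℂ)
  have h3 : (AddCircle.toCircle y : ℂ).re = 1 := h
  rw [h1, h3] at h2
  apply Complex.ext
  · simpa using h3
  · simpa using (show (AddCircle.toCircle y : ℂ).im = 0 by nlinarith)

/-- A smooth function on `ℝ × 𝕋³`, supported in `|t| ≤ δ`, with a unique maximum at `0`; its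
normalized powers are an approximate identity. -/
def peak (δ : ℝ) (z : ℝ × Torus L) : ℝ :=
  expNegInvGlue (δ ^ 2 - z.1 ^ 2) * (3 + ∑ i, circleCos (z.2 i))

theorem smoothPer_peak (δ : ℝ) : SmoothPer (peak δ : ℝ × Torus L → ℝ) := by
  have : lift (peak δ : ℝ × Torus L → ℝ) = fun z =>
      expNegInvGlue (δ ^ 2 - z.1 ^ 2) * (3 + ∑ i, Real.cos (2 * Real.pi / L * z.2 i)) := by
    ext z
    simp [lift, peak, proj, circleCos_mk]
  rw [SmoothPer, this]
  refine (expNegInvGlue.contDiff.comp (by fun_prop)).mul (contDiff_const.add ?_)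
  refine ContDiff.sum fun i _ => Real.contDiff_cos.comp (contDiff_const.mul ?_)
  have h : ContDiff ℝ ∞ fun l : E3 => l i := contDiff_piLp_apply 2
  exact h.comp contDiff_snd

theorem sum_circleCos_nonneg (x : Torus L) : 0 ≤ 3 + ∑ i, circleCos (x i) := by
  have := fun i => neg_one_le_circleCos (x i)
  rw [Fin.sum_univ_three]
  linarith [this 0, this 1, this 2]

theorem peak_nonneg (δ : ℝ) (z : ℝ × Torus L) : 0 ≤ peak δ z :=
  mul_nonneg (expNegInvGlue.nonneg _) (sum_circleCos_nonneg _)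

theorem peak_zero_pos {δ : ℝ} (hδ : 0 < δ) : 0 < peak δ (0 : ℝ × Torus L) := by
  refine mul_pos (expNegInvGlue.pos_of_pos ?_) ?_
  · simp only [Prod.fst_zero]
    nlinarith
  · simp [circleCos_zero]

theorem timeSupported_peak {δ : ℝ} (hδ : 0 < δ) :
    TimeSupported (-δ) δ (peak δ : ℝ × Torus L → ℝ) := by
  intro t x ht
  rw [mem_Icc, ← abs_le, not_le] at ht
  have : δ ^ 2 - t ^ 2 ≤ 0 := by
    have := sq_abs t
    nlinarith
  simp [peak, expNegInvGlue.zero_of_nonpos this]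

theorem peak_lt [Fact (0 < L)] {δ : ℝ} (hδ : 0 < δ) {z : ℝ × Torus L} (hz : z ≠ 0) :
    peak δ z < peak δ (0 : ℝ × Torus L) := by
  have hδ2 : 0 < δ ^ 2 := by positivity
  have hpos : 0 < expNegInvGlue (δ ^ 2) := expNegInvGlue.pos_of_pos hδ2
  have h0 : peak δ (0 : ℝ × Torus L) = expNegInvGlue (δ ^ 2) * 6 := by
    simp [peak, circleCos_zero]
    norm_num
  rw [h0, peak]
  have hle : ∀ i, circleCos (z.2 i) ≤ 1 := fun i => circleCos_le_one _
  have hsum : 3 + ∑ i, circleCos (z.2 i) ≤ 6 := by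
    rw [Fin.sum_univ_three]
    linarith [hle 0, hle 1, hle 2]
  by_cases ht : z.1 = 0
  · have hx : ∃ i, z.2 i ≠ 0 := by
      by_contra! h
      exact hz (Prod.ext ht (funext h))
    obtain ⟨i, hi⟩ := hx
    have hlt : ∑ i, circleCos (z.2 i) < ∑ _ : Fin 3, (1 : ℝ) :=
      Finset.sum_lt_sum (fun i _ => hle i) ⟨i, Finset.mem_univ _, circleCos_lt_one hi⟩
    simp at hlt
    simp only [ht, ne_eq, OfNat.ofNat_ne_zero, not_false_eq_true, zero_pow, sub_zero]
    exact mul_lt_mul_of_pos_left (by linarith) hpos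
  · have hsq : 0 < z.1 ^ 2 := by positivity
    have hlt : expNegInvGlue (δ ^ 2 - z.1 ^ 2) < expNegInvGlue (δ ^ 2) := by
      by_cases h : δ ^ 2 - z.1 ^ 2 ≤ 0
      · rw [expNegInvGlue.zero_of_nonpos h]
        exact hpos
      · rw [expNegInvGlue, expNegInvGlue, if_neg h, if_neg hδ2.not_ge, Real.exp_lt_exp]
        exact neg_lt_neg (inv_strictAnti₀ (not_le.1 h) (by linarith))
    calc _ ≤ expNegInvGlue (δ ^ 2 - z.1 ^ 2) * 6 :=
          mul_le_mul_of_nonneg_left hsum (expNegInvGlue.nonneg _)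
      _ < _ := by linarith

theorem SmoothPer.pow {f : ℝ × Torus L → ℝ} (hf : SmoothPer f) (n : ℕ) :
    SmoothPer fun z => f z ^ n :=
  ContDiff.pow hf n

variable [Fact (0 < L)]

/-- The compact set `[-δ, δ] × 𝕋³`. -/
def timeStrip (L δ : ℝ) : Set (ℝ × Torus L) := Icc (-δ) δ ×ˢ univ

theorem isCompact_timeStrip (δ : ℝ) : IsCompact (timeStrip L δ) :=
  isCompact_Icc.prod isCompact_univ

/-- The normalized powers of `peak` are an approximate identity on `timeStrip`. -/
theorem tendsto_peak {δ : ℝ} (hδ : 0 < δ) {f : ℝ × Torus L → ℝ} (hf : Continuous f) :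
    Tendsto (fun n : ℕ => (∫ z in timeStrip L δ, peak δ z ^ n)⁻¹ *
      ∫ z in timeStrip L δ, peak δ z ^ n * f z) atTop (𝓝 (f 0)) := by
  refine tendsto_setIntegral_pow_smul_of_unique_maximum_of_isCompact_of_integrableOn
    (isCompact_timeStrip δ) (smoothPer_peak δ).continuous.continuousOn
    (fun y _ hy => peak_lt hδ hy) (fun x _ => peak_nonneg δ x) (peak_zero_pos hδ)
    (subset_closure ?_) (hf.continuousOn.integrableOn_compact (isCompact_timeStrip δ))
    hf.continuousWithinAt
  rw [timeStrip, interior_prod_eq, interior_Icc, interior_univ]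
  exact ⟨⟨by simpa using hδ, by simpa using hδ⟩, mem_univ _⟩

theorem setIntegral_timeStrip {δ : ℝ} {f : ℝ × Torus L → ℝ} (hf : TimeSupported (-δ) δ f) :
    ∫ z in timeStrip L δ, f z = ∫ z, f z :=
  setIntegral_eq_integral_of_forall_compl_eq_zero fun z hz =>
    hf z.1 z.2 fun h => hz ⟨h, mem_univ _⟩

/-- A purely spatial increment. -/
def inc (L : ℝ) (l : E3) : ℝ × Torus L := (0, proj L l)

omit [Fact (0 < L)] in
theorem continuous_inc : Continuous (inc L) := continuous_const.prodMk continuous_proj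

omit [Fact (0 < L)] in
theorem SmoothPer.differentiableAt_comp_inc {η : ℝ × Torus L → ℝ} (hη : SmoothPer η)
    (h : ℝ × Torus L) (l : E3) :
    DifferentiableAt ℝ (fun l => η (h - inc L l)) l ∧
      ∀ i, fderiv ℝ (fun l => η (h - inc L l)) l (basisVec i) = -pd i η (h - inc L l) := by
  have hs := hη.comp_const_sub h
  have h0 : HasFDerivAt (fun l' : E3 => ((0 : ℝ), l')) (ContinuousLinearMap.inr ℝ ℝ E3) l :=
    (ContinuousLinearMap.inr ℝ ℝ E3).hasFDerivAt
  have h1 : HasFDerivAt (fun l => η (h - inc L l)) _ l := (hs.hasFDerivAt (0, l)).comp l h0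
  refine ⟨h1.differentiableAt, fun i => ?_⟩
  rw [h1.fderiv]
  have := hs.pd_eq i 0 l
  rw [hη.pd_comp_const_sub] at this
  simpa [inc] using this.symm

theorem integrable_fderiv_kernel {g : E3 → ℝ} (hg : Continuous g) (hgs : HasCompactSupport g)
    {κ f : ℝ × Torus L → ℝ} {δ : ℝ} (hκ : Continuous κ) (hκs : TimeSupported (-δ) δ κ)
    (hf : Continuous f) :
    Integrable (fun x : E3 × (ℝ × Torus L) => g x.1 * (κ (x.2 - inc L x.1) * f x.2))
      (volume.prod volume) := by
  have hc : Continuous fun x : E3 × (ℝ × Torus L) => g x.1 * (κ (x.2 - inc L x.1) * f x.2) := by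
    have := continuous_inc (L := L)
    fun_prop
  refine hc.integrable_of_hasCompactSupport ?_
  refine HasCompactSupport.intro (K := tsupport g ×ˢ timeStrip L δ)
    (IsCompact.prod hgs (isCompact_timeStrip δ)) ?_
  rintro ⟨l, t, x⟩ hx
  by_cases hl : l ∈ tsupport g
  · have ht : t ∉ Icc (-δ) δ := fun h => hx ⟨hl, h, mem_univ _⟩
    have : κ ((t, x) - inc L l) = 0 := hκs _ _ (by simpa [inc] using ht)
    simp [this]
  · simp [image_eq_zero_of_notMem_tsupport hl]

/-- If `∑ᵢ ∂ᵢ Fᵢ = G` holds when tested against smooth kernels on `ℝ × 𝕋³`, then it holds for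
the restrictions to purely spatial increments, tested against `C¹` functions on `ℝ³`: average over
the translates `η(· - (0, l))` with weight `φ(l)`, then concentrate `η` at the origin. The time
variable and the periodicity disappear in the limit because `F` and `G` are continuous. -/
theorem sum_integral_fderiv_mul_of_kernel {δ : ℝ} (hδ : 0 < δ) {F : Fin 3 → ℝ × Torus L → ℝ}
    {G : ℝ × Torus L → ℝ} (hF : ∀ i, Continuous (F i)) (hG : Continuous G)
    (H : ∀ η : ℝ × Torus L → ℝ, SmoothPer η → TimeSupported (-δ) δ η →
      ∑ i, ∫ h, pd i η h * F i h = -∫ h, η h * G h)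
    {φ : E3 → ℝ} (hφ : ContDiff ℝ 1 φ) (hφs : HasCompactSupport φ) :
    ∑ i, ∫ l, fderiv ℝ φ l (basisVec i) * F i (inc L l) = -∫ l, φ l * G (inc L l) := by
  have hdc : ∀ i, Continuous fun l => fderiv ℝ φ l (basisVec i) := fun i =>
    (hφ.continuous_fderiv (by simp)).clm_apply continuous_const
  have hds : ∀ i, HasCompactSupport fun l => fderiv ℝ φ l (basisVec i) := fun i =>
    hφs.fderiv_apply (𝕜 := ℝ) _
  -- the identity tested against translates of a fixed kernel
  have step : ∀ η : ℝ × Torus L → ℝ, SmoothPer η → TimeSupported (-δ) δ η →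
      ∑ i, ∫ l, fderiv ℝ φ l (basisVec i) * ∫ h, η (h - inc L l) * F i h
        = -∫ l, φ l * ∫ h, η (h - inc L l) * G h := by
    intro η hη hηs
    have e : ∀ i, ∫ l, fderiv ℝ φ l (basisVec i) * ∫ h, η (h - inc L l) * F i h
        = ∫ l, φ l * ∫ h, pd i η (h - inc L l) * F i h := by
      intro i
      simp_rw [← integral_const_mul]
      rw [integral_integral_swap (f := fun l h =>
          fderiv ℝ φ l (basisVec i) * (η (h - inc L l) * F i h))
        (integrable_fderiv_kernel (hdc i) (hds i) hη.continuous hηs (hF i)),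
        integral_integral_swap (f := fun l h => φ l * (pd i η (h - inc L l) * F i h))
        (integrable_fderiv_kernel hφ.continuous hφs (hη.continuous_pd i) (hηs.pd i) (hF i))]
      congr 1 with h
      simp_rw [← mul_assoc]
      rw [integral_mul_const, integral_mul_const]
      congr 1
      have c1 : Continuous fun l => η (h - inc L l) :=
        hη.continuous.comp (continuous_const.sub continuous_inc)
      have c2 : Continuous fun l => pd i η (h - inc L l) :=
        (hη.continuous_pd i).comp (continuous_const.sub continuous_inc)
      have hd := fun l => hη.differentiableAt_comp_inc h l
      have ibp := integral_mul_fderiv_eq_neg_fderiv_mul_of_integrable (μ := (volume : Measure E3))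
        (f := φ) (g := fun l => η (h - inc L l)) (v := basisVec i)
        (((hdc i).mul c1).integrable_of_hasCompactSupport (hds i).mul_right)
        (by
          simp_rw [(hd _).2 i]
          exact (hφ.continuous.mul c2.neg).integrable_of_hasCompactSupport hφs.mul_right)
        ((hφ.continuous.mul c1).integrable_of_hasCompactSupport hφs.mul_right)
        (fun l _ => hφ.differentiable (by simp) l) (fun l _ => (hd l).1)
      simp_rw [(hd _).2 i, mul_neg, integral_neg] at ibp
      linarith
    simp_rw [e]
    have i1 : ∀ i, Integrable fun l => φ l * ∫ h, pd i η (h - inc L l) * F i h := fun i => by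
      have := (integrable_fderiv_kernel hφ.continuous hφs (hη.continuous_pd i) (hηs.pd i)
        (hF i)).integral_prod_left
      simpa only [integral_const_mul] using this
    rw [← integral_finsetSum _ fun i _ => i1 i, ← integral_neg]
    congr 1 with l
    rw [← Finset.mul_sum, ← mul_neg]
    congr 1
    have h1 := H (fun h => η (h - inc L l)) (hη.comp_sub_const _)
      (fun t x ht => hηs _ _ (by simpa [inc] using ht))
    simpa only [pd_comp_sub_const] using h1
  -- normalized averages of a continuous function against the peak kernels
  set I : ℕ → ℝ := fun n => (∫ z in timeStrip L δ, peak δ z ^ n)⁻¹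
  set A : (ℝ × Torus L → ℝ) → ℕ → E3 → ℝ := fun f n l =>
    I n * ∫ h in timeStrip L δ, peak δ h ^ n * f (h + inc L l)
  have hA : ∀ (f : ℝ × Torus L → ℝ) (n : ℕ) (l : E3), n ≠ 0 →
      A f n l = I n * ∫ h, peak δ (h - inc L l) ^ n * f h := by
    intro f n l hn
    simp only [A]
    congr 1
    rw [setIntegral_timeStrip fun t x ht => by simp [timeSupported_peak hδ t x ht, hn],
      ← integral_add_right_eq_self (fun h => peak δ (h - inc L l) ^ n * f h) (inc L l)]
    simp
  have hpc : Continuous (peak δ : ℝ × Torus L → ℝ) := (smoothPer_peak δ).continuous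
  have hI : ∀ n, 0 ≤ I n := fun n => inv_nonneg.2 <|
    setIntegral_nonneg (isCompact_timeStrip δ).measurableSet fun z _ => pow_nonneg (peak_nonneg δ z) n
  have limA : ∀ f : ℝ × Torus L → ℝ, Continuous f → ∀ g : E3 → ℝ, Continuous g →
      HasCompactSupport g → Tendsto (fun n => ∫ l, g l * A f n l) atTop
        (𝓝 (∫ l, g l * f (inc L l))) := by
    intro f hf g hg hgs
    obtain ⟨M, hM⟩ : ∃ M, ∀ z ∈ timeStrip L δ, ‖f z‖ ≤ M :=
      (isCompact_timeStrip δ).exists_bound_of_continuousOn hf.continuousOn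
    have hM0 : 0 ≤ M := (norm_nonneg _).trans (hM 0 ⟨⟨by simpa using hδ.le, by simpa using hδ.le⟩,
      mem_univ _⟩)
    have hcont : ∀ n, Continuous (A f n) := fun n => by
      refine continuous_const.mul (continuous_parametric_integral_of_continuous ?_
        (isCompact_timeStrip δ))
      have := continuous_inc (L := L)
      fun_prop
    refine tendsto_integral_of_dominated_convergence (fun l => ‖g l‖ * M) ?_ ?_ ?_ ?_
    · exact fun n => (hg.mul (hcont n)).aestronglyMeasurable
    · exact ((hg.norm.mul continuous_const).integrable_of_hasCompactSupport
        (HasCompactSupport.mul_right hgs.norm))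
    · intro n
      refine Eventually.of_forall fun l => ?_
      rw [norm_mul]
      gcongr
      simp only [A]
      have hint : IntegrableOn (fun h => peak δ h ^ n) (timeStrip L δ) volume :=
        (hpc.pow n).continuousOn.integrableOn_compact (isCompact_timeStrip δ)
      rw [norm_mul, Real.norm_of_nonneg (hI n)]
      calc _ ≤ I n * ∫ h in timeStrip L δ, peak δ h ^ n * M := by
            gcongr
            · exact hI n
            refine norm_integral_le_of_norm_le (hint.mul_const M) ?_
            filter_upwards [ae_restrict_mem (isCompact_timeStrip δ).measurableSet] with h hh
            rw [norm_mul, Real.norm_of_nonneg (pow_nonneg (peak_nonneg δ h) n)]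
            refine mul_le_mul_of_nonneg_left (hM _ ?_) (pow_nonneg (peak_nonneg δ h) n)
            exact ⟨by simpa [inc] using hh.1, mem_univ _⟩
        _ ≤ M := by
            rw [integral_mul_const, ← mul_assoc]
            refine mul_le_of_le_one_left hM0 ?_
            simp only [I]
            exact inv_mul_le_one
    · refine Eventually.of_forall fun l => Tendsto.const_mul _ ?_
      have := tendsto_peak (L := L) hδ (f := fun h => f (h + inc L l)) (by fun_prop)
      simpa using this
  have key : ∀ n : ℕ, ∑ i, ∫ l, fderiv ℝ φ l (basisVec i) * A (F i) (n + 1) l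
      = -∫ l, φ l * A G (n + 1) l := by
    intro n
    have h1 := step (fun z => peak δ z ^ (n + 1)) ((smoothPer_peak δ).pow _)
      (fun t x ht => by simp [timeSupported_peak hδ t x ht])
    simp_rw [hA _ _ _ n.succ_ne_zero, mul_left_comm _ (I (n + 1)), integral_const_mul]
    rw [← Finset.mul_sum, h1, mul_neg]
  have l1 := tendsto_finsetSum Finset.univ fun i _ =>
    ((limA (F i) (hF i) _ (hdc i) (hds i)).comp (tendsto_add_atTop_nat 1))
  have l2 := ((limA G hG φ hφ.continuous hφs).comp (tendsto_add_atTop_nat 1)).neg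
  refine tendsto_nhds_unique l1 (l2.congr fun n => ?_)
  exact (key n).symm

end

section

/-! ### Ball and sphere averages of a field with continuous distributional divergence -/

/-- Integration in polar coordinates. -/
theorem integral_eq_integral_sphere {f : E3 → ℝ} (hf : Integrable f) :
    ∫ l, f l = ∫ r in Ioi (0 : ℝ), r ^ 2 * ∫ ζ, f (r • (ζ : E3)) ∂surfaceMeasure := by
  have hdim : Module.finrank ℝ E3 = 3 := by simp
  set e := homeomorphUnitSphereProd E3
  have hmp := (volume : Measure E3).measurePreserving_homeomorphUnitSphereProd
  have hval : ∀ x : Metric.sphere (0 : E3) 1 × Ioi (0 : ℝ),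
      ((e.symm x : ({0}ᶜ : Set E3)) : E3) = (x.2 : ℝ) • (x.1 : E3) := fun x => rfl
  set g : Metric.sphere (0 : E3) 1 × Ioi (0 : ℝ) → ℝ := fun x => f ((x.2 : ℝ) • (x.1 : E3))
  have hg : ∀ y : ({0}ᶜ : Set E3), g (e y) = f y := fun y => by
    simp only [g]
    rw [← hval, e.symm_apply_apply]
  have hi : Integrable (fun y : ({0}ᶜ : Set E3) => f y) (volume.comap Subtype.val) := by
    rw [← Function.comp_def f, ← integrableOn_iff_comap_subtypeVal (measurableSet_singleton _).compl]
    exact hf.integrableOn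
  have hgi : Integrable g ((volume : Measure E3).toSphere.prod
      (.volumeIoiPow (Module.finrank ℝ E3 - 1))) := by
    rw [← hmp.integrable_comp_emb (Homeomorph.measurableEmbedding _)]
    exact hi.congr (Eventually.of_forall fun y => (hg y).symm)
  calc ∫ l, f l = ∫ y : ({0}ᶜ : Set E3), f y ∂(volume.comap Subtype.val) := by
        rw [integral_subtype_comap (measurableSet_singleton _).compl fun x => f x,
          restrict_compl_singleton]
    _ = ∫ x, g x ∂((volume : Measure E3).toSphere.prod
          (.volumeIoiPow (Module.finrank ℝ E3 - 1))) := by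
        rw [← hmp.integral_comp (Homeomorph.measurableEmbedding _) g]
        exact integral_congr_ae (Eventually.of_forall fun y => (hg y).symm)
    _ = ∫ r : Ioi (0 : ℝ), ∫ ζ, f ((r : ℝ) • (ζ : E3)) ∂surfaceMeasure
          ∂(Measure.volumeIoiPow (Module.finrank ℝ E3 - 1)) := integral_prod_symm g hgi
    _ = _ := by
        rw [hdim]
        simp only [Measure.volumeIoiPow, ENNReal.ofReal]
        rw [integral_withDensity_eq_integral_smul
          (measurable_subtype_coe.pow_const _).real_toNNReal,
          integral_subtype_comap measurableSet_Ioi fun r : ℝ => Real.toNNReal (r ^ (3 - 1)) •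
            ∫ ζ, f (r • (ζ : E3)) ∂surfaceMeasure,
          setIntegral_congr_fun measurableSet_Ioi fun r hr => ?_]
        rw [NNReal.smul_def, Real.coe_toNNReal _ (pow_nonneg (le_of_lt hr) _), smul_eq_mul]

theorem surfaceMeasure_real_univ : surfaceMeasure.real univ = 4 * Real.pi := by
  have h : (volume : Measure E3).real (Metric.ball 0 1) = Real.pi * 4 / 3 := by
    rw [measureReal_def, EuclideanSpace.volume_ball_fin_three]
    simp [ENNReal.toReal_ofReal (by positivity : (0 : ℝ) ≤ Real.pi * 4 / 3)]
  rw [surfaceMeasure, Measure.toSphere_real_apply_univ, h]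
  simp
  ring

/-- The integral of `f` over the sphere of radius `r`, with respect to the surface measure of the
unit sphere. -/
def sphereInt (f : E3 → ℝ) (r : ℝ) : ℝ := ∫ ζ, f (r • (ζ : E3)) ∂surfaceMeasure

theorem continuous_sphereInt {f : E3 → ℝ} (hf : Continuous f) : Continuous (sphereInt f) := by
  have := continuous_parametric_integral_of_continuous (μ := surfaceMeasure)
    (f := fun (r : ℝ) (ζ : Metric.sphere (0 : E3) 1) => f (r • (ζ : E3))) (by fun_prop)
    (isCompact_univ)
  simp only [Measure.restrict_univ] at this
  exact this

variable {F : Fin 3 → E3 → ℝ} {G : E3 → ℝ}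

/-- The surface integral `∫_{|ζ|=1} ζ · F(rζ) dσ(ζ)`. -/
def sphereFlux (F : Fin 3 → E3 → ℝ) (r : ℝ) : ℝ :=
  ∫ ζ : Metric.sphere (0 : E3) 1, ∑ i, (ζ : E3) i * F i (r • (ζ : E3)) ∂surfaceMeasure

theorem continuous_coord (i : Fin 3) : Continuous fun l : E3 => l i :=
  (contDiff_piLp_apply (𝕜 := ℝ) (n := 0) 2).continuous

theorem continuous_sphereFlux (hF : ∀ i, Continuous (F i)) : Continuous (sphereFlux F) := by
  have := continuous_parametric_integral_of_continuous (μ := surfaceMeasure)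
    (f := fun (r : ℝ) (ζ : Metric.sphere (0 : E3) 1) => ∑ i, (ζ : E3) i * F i (r • (ζ : E3)))
    (by
      refine continuous_finsetSum _ fun i _ => Continuous.mul ?_ ?_
      · exact (continuous_coord i).comp (continuous_subtype_val.comp continuous_snd)
      · exact (hF i).comp (by fun_prop))
    (isCompact_univ)
  simp only [Measure.restrict_univ] at this
  exact this

/-- The divergence identity against radial test functions `l ↦ Φ(|l|²)`, in polar coordinates. -/
theorem integral_Ioi_radial (hF : ∀ i, Continuous (F i)) (hG : Continuous G)
    (H : ∀ φ : E3 → ℝ, ContDiff ℝ 1 φ → HasCompactSupport φ →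
      ∑ i, ∫ l, fderiv ℝ φ l (basisVec i) * F i l = -∫ l, φ l * G l)
    {Φ ϕ : ℝ → ℝ} (hΦ : ∀ u, HasDerivAt Φ (ϕ u) u) (hϕ : Continuous ϕ) {R : ℝ}
    (hΦR : ∀ u, R ^ 2 ≤ u → Φ u = 0) :
    ∫ r in Ioi (0 : ℝ), 2 * r * ϕ (r ^ 2) * (r ^ 2 * sphereFlux F r)
      = -∫ r in Ioi (0 : ℝ), Φ (r ^ 2) * (r ^ 2 * sphereInt G r) := by
  have hΦ1 : ContDiff ℝ 1 Φ := by
    rw [contDiff_one_iff_deriv]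
    refine ⟨fun u => (hΦ u).differentiableAt, ?_⟩
    rwa [show deriv Φ = ϕ from funext fun u => (hΦ u).deriv]
  have hφ : ContDiff ℝ 1 fun l : E3 => Φ (‖l‖ ^ 2) := hΦ1.comp (contDiff_norm_sq ℝ)
  have hball : ∀ l : E3, l ∉ Metric.closedBall (0 : E3) |R| → R ^ 2 ≤ ‖l‖ ^ 2 := fun l hl => by
    rw [mem_closedBall_zero_iff, not_le] at hl
    rw [← sq_abs R]
    exact pow_le_pow_left₀ (abs_nonneg R) hl.le 2
  have hs : HasCompactSupport fun l : E3 => Φ (‖l‖ ^ 2) :=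
    HasCompactSupport.intro (isCompact_closedBall (0 : E3) |R|) fun l hl => hΦR _ (hball l hl)
  have hfd : ∀ l i, fderiv ℝ (fun l : E3 => Φ (‖l‖ ^ 2)) l (basisVec i)
      = 2 * ϕ (‖l‖ ^ 2) * l i := by
    intro l i
    have h2 : HasFDerivAt (fun l : E3 => Φ (‖l‖ ^ 2)) _ l :=
      (hΦ (‖l‖ ^ 2)).comp_hasFDerivAt l (hasStrictFDerivAt_norm_sq l).hasFDerivAt
    rw [h2.fderiv]
    simp [basisVec, EuclideanSpace.inner_single_right]
    ring
  have h := H _ hφ hs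
  have hint : ∀ i, Integrable fun l => fderiv ℝ (fun l : E3 => Φ (‖l‖ ^ 2)) l (basisVec i) * F i l :=
    fun i => (((hφ.continuous_fderiv (by simp)).clm_apply continuous_const).mul
      (hF i)).integrable_of_hasCompactSupport (hs.fderiv_apply (𝕜 := ℝ) _).mul_right
  have hint' : Integrable fun l => Φ (‖l‖ ^ 2) * G l :=
    (hφ.continuous.mul hG).integrable_of_hasCompactSupport hs.mul_right
  rw [← integral_finsetSum _ fun i _ => hint i,
    integral_eq_integral_sphere (integrable_finsetSum _ fun i _ => hint i),
    integral_eq_integral_sphere hint'] at h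
  have hnorm : ∀ r ∈ Ioi (0 : ℝ), ∀ ζ : Metric.sphere (0 : E3) 1, ‖r • (ζ : E3)‖ = r := by
    intro r hr ζ
    rw [norm_smul, norm_eq_of_mem_sphere, mul_one, Real.norm_of_nonneg (le_of_lt hr)]
  have e1 : ∫ r in Ioi (0 : ℝ), 2 * r * ϕ (r ^ 2) * (r ^ 2 * sphereFlux F r)
      = ∫ r in Ioi (0 : ℝ), r ^ 2 * ∫ ζ : Metric.sphere (0 : E3) 1,
        ∑ i, fderiv ℝ (fun l : E3 => Φ (‖l‖ ^ 2)) (r • (ζ : E3)) (basisVec i)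
          * F i (r • (ζ : E3)) ∂surfaceMeasure := by
    refine setIntegral_congr_fun measurableSet_Ioi fun r hr => ?_
    simp only [hfd, hnorm r hr, sphereFlux]
    rw [mul_left_comm, ← integral_const_mul]
    congr 2
    ext ζ
    rw [Finset.mul_sum]
    refine Finset.sum_congr rfl fun i _ => ?_
    simp
    ring
  have e2 : ∫ r in Ioi (0 : ℝ), Φ (r ^ 2) * (r ^ 2 * sphereInt G r)
      = ∫ r in Ioi (0 : ℝ), r ^ 2 * ∫ ζ : Metric.sphere (0 : E3) 1,
        Φ (‖r • (ζ : E3)‖ ^ 2) * G (r • (ζ : E3)) ∂surfaceMeasure := by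
    refine setIntegral_congr_fun measurableSet_Ioi fun r hr => ?_
    simp only [hnorm r hr, sphereInt]
    rw [mul_left_comm, ← integral_const_mul]
  rw [e1, e2, h]

/-- The divergence theorem on balls, for a continuous field `F` with continuous distributional
divergence `G`. Radial test functions determine `r² ∫ ζ · F(rζ) dσ(ζ)` for almost every `r`, and
by continuity for every `r > 0`. -/
theorem sq_mul_sphereFlux (hF : ∀ i, Continuous (F i)) (hG : Continuous G)
    (H : ∀ φ : E3 → ℝ, ContDiff ℝ 1 φ → HasCompactSupport φ →
      ∑ i, ∫ l, fderiv ℝ φ l (basisVec i) * F i l = -∫ l, φ l * G l) {r : ℝ} (hr : 0 < r) :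
    r ^ 2 * sphereFlux F r = ∫ s in (0 : ℝ)..r, s ^ 2 * sphereInt G s := by
  have hcG := continuous_sphereInt hG
  have hcF := continuous_sphereFlux hF
  have hB : Continuous fun s => s ^ 2 * sphereInt G s := by fun_prop
  set C : ℝ → ℝ := fun r => ∫ s in (0 : ℝ)..r, s ^ 2 * sphereInt G s
  have hC : ∀ r, HasDerivAt C (r ^ 2 * sphereInt G r) r := fun r =>
    intervalIntegral.integral_hasDerivAt_right (hB.intervalIntegrable _ _)
      (hB.stronglyMeasurableAtFilter _ _) hB.continuousAt
  have hCc : Continuous C := continuous_iff_continuousAt.2 fun r => (hC r).continuousAt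
  set J : ℝ → ℝ := fun r => r ^ 2 * sphereFlux F r - C r
  have hJ : Continuous J := by fun_prop
  have hJs : Continuous fun u => J (Real.sqrt u) := hJ.comp Real.continuous_sqrt
  have key : ∀ᵐ u : ℝ, u ∈ Ioi (0 : ℝ) → J (Real.sqrt u) = 0 := by
    refine isOpen_Ioi.ae_eq_zero_of_integral_contDiff_smul_eq_zero
      (hJs.locallyIntegrable.locallyIntegrableOn _) fun ϕ hϕ hϕs hϕ0 => ?_
    have hϕc : Continuous ϕ := hϕ.continuous
    have hϕneg : ∀ u, u ∉ Ioi (0 : ℝ) → ϕ u = 0 := fun u hu =>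
      image_eq_zero_of_notMem_tsupport fun h => hu (hϕ0 h)
    obtain ⟨R, hR, hRϕ⟩ : ∃ R : ℝ, 0 < R ∧ ∀ u, R ^ 2 ≤ u → ϕ u = 0 := by
      obtain ⟨B, hB⟩ := hϕs.isBounded.subset_closedBall 0
      refine ⟨max B 0 + 1, by positivity, fun u hu => ?_⟩
      by_contra hne
      have h1 := hB (subset_tsupport ϕ hne)
      rw [mem_closedBall_zero_iff] at h1
      have h2 := (le_abs_self u).trans h1
      nlinarith [le_max_left B 0, le_max_right B 0]
    set Φ : ℝ → ℝ := fun u => ∫ w in (R ^ 2)..u, ϕ w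
    have hΦ : ∀ u, HasDerivAt Φ (ϕ u) u := fun u =>
      intervalIntegral.integral_hasDerivAt_right (hϕc.intervalIntegrable _ _)
        (hϕc.stronglyMeasurableAtFilter _ _) hϕc.continuousAt
    have hΦR : ∀ u, R ^ 2 ≤ u → Φ u = 0 := fun u hu => by
      refine intervalIntegral.integral_zero_ae (Eventually.of_forall fun w hw => ?_)
      rw [uIoc_of_le hu] at hw
      exact hRϕ w hw.1.le
    have hΦc : Continuous Φ := continuous_iff_continuousAt.2 fun r => (hΦ r).continuousAt
    have h1 := integral_Ioi_radial hF hG H hΦ hϕc hΦR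
    -- both integrands vanish beyond `R`
    have cut : ∀ g : ℝ → ℝ, (∀ s, R ≤ s → g s = 0) →
        ∫ s in Ioi (0 : ℝ), g s = ∫ s in (0 : ℝ)..R, g s := by
      intro g hg
      rw [intervalIntegral.integral_of_le hR.le]
      refine setIntegral_eq_of_subset_of_forall_sdiff_eq_zero measurableSet_Ioi
        (fun s hs => hs.1) fun s hs => hg s ?_
      by_contra! h
      exact hs.2 ⟨hs.1, h.le⟩
    have hsq : ∀ s, R ≤ s → R ^ 2 ≤ s ^ 2 := fun s hs => pow_le_pow_left₀ hR.le hs 2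
    have h2 := intervalIntegral.integral_mul_deriv_eq_deriv_mul (a := 0) (b := R)
      (u := fun s => Φ (s ^ 2)) (u' := fun s => 2 * s * ϕ (s ^ 2)) (v := C)
      (v' := fun s => s ^ 2 * sphereInt G s)
      (fun s _ => by
        have := (hΦ (s ^ 2)).comp s (hasDerivAt_pow 2 s)
        simpa [mul_comm, Function.comp_def] using this)
      (fun s _ => hC s) (Continuous.intervalIntegrable (by fun_prop) _ _)
      (hB.intervalIntegrable _ _)
    have hC0 : C 0 = 0 := intervalIntegral.integral_same
    rw [hΦR _ le_rfl, hC0, mul_zero, zero_mul, sub_zero, zero_sub] at h2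
    rw [cut _ fun s hs => by rw [hRϕ _ (hsq s hs)]; ring,
      cut _ fun s hs => by rw [hΦR _ (hsq s hs)]; ring, h2, neg_neg] at h1
    have h3 : ∫ s in Ioi (0 : ℝ), 2 * s * ϕ (s ^ 2) * J s = 0 := by
      rw [cut _ fun s hs => by rw [hRϕ _ (hsq s hs)]; ring]
      simp only [J, mul_sub]
      rw [intervalIntegral.integral_sub (Continuous.intervalIntegrable (by fun_prop) _ _)
        (Continuous.intervalIntegrable (by fun_prop) _ _)]
      linarith
    -- the substitution `u = s²`
    have h4 := integral_comp_rpow_Ioi_of_pos (g := fun u => ϕ u * J (Real.sqrt u))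
      (p := 2) (by norm_num)
    simp only [smul_eq_mul] at h4 ⊢
    rw [← setIntegral_eq_integral_of_forall_compl_eq_zero (s := Ioi 0) fun u hu => by
      rw [hϕneg u hu, zero_mul], ← h4]
    refine Eq.trans (setIntegral_congr_fun measurableSet_Ioi fun s hs => ?_) h3
    have e1 : s ^ (2 - 1 : ℝ) = s := by norm_num
    have e2 : s ^ (2 : ℝ) = s ^ 2 := Real.rpow_natCast s 2
    simp only [e1, e2, Real.sqrt_sq (le_of_lt hs)]
    ring
  have h5 : EqOn (fun u => J (Real.sqrt u)) (fun _ => 0) (Ioi 0) :=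
    Measure.eqOn_open_of_ae_eq (μ := volume) ((ae_restrict_iff' measurableSet_Ioi).2 key)
      isOpen_Ioi hJs.continuousOn continuousOn_const
  have h6 := h5 (x := r ^ 2) (mem_Ioi.2 (by positivity))
  simp only [Real.sqrt_sq hr.le, J] at h6
  linarith

/-- Shrinking sphere averages: `(4π r)⁻¹ ∫ ζ · F(rζ) dσ(ζ) → G(0) / 3`. The factor `1 / 3` is the
ratio of the volume of the unit ball to the area of the unit sphere. -/
theorem tendsto_sphereFlux (hF : ∀ i, Continuous (F i)) (hG : Continuous G)
    (H : ∀ φ : E3 → ℝ, ContDiff ℝ 1 φ → HasCompactSupport φ →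
      ∑ i, ∫ l, fderiv ℝ φ l (basisVec i) * F i l = -∫ l, φ l * G l) :
    Tendsto (fun r => 1 / r * (1 / (4 * Real.pi) * sphereFlux F r)) (𝓝[>] 0) (𝓝 (G 0 / 3)) := by
  have hcG := continuous_sphereInt hG
  have hc : Continuous fun r : ℝ => 1 / (4 * Real.pi) *
      ∫ u in (0 : ℝ)..1, u ^ 2 * sphereInt G (r * u) := by
    refine continuous_const.mul
      (intervalIntegral.continuous_parametric_intervalIntegral_of_continuous' ?_ 0 1)
    fun_prop
  have h0 : 1 / (4 * Real.pi) * ∫ u in (0 : ℝ)..1, u ^ 2 * sphereInt G (0 * u) = G 0 / 3 := by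
    have : sphereInt G 0 = 4 * Real.pi * G 0 := by
      simp [sphereInt, surfaceMeasure_real_univ]
    simp only [zero_mul, this]
    rw [intervalIntegral.integral_mul_const, integral_pow]
    have := Real.pi_ne_zero
    field_simp
    ring
  rw [← h0]
  refine ((hc.tendsto 0).mono_left nhdsWithin_le_nhds).congr' ?_
  filter_upwards [self_mem_nhdsWithin] with r hr
  have hr : 0 < r := hr
  have h1 := sq_mul_sphereFlux hF hG H hr
  have h2 := intervalIntegral.integral_comp_mul_left (a := 0) (b := 1)
    (fun s => s ^ 2 * sphereInt G s) hr.ne'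
  simp only [mul_zero, mul_one, smul_eq_mul, mul_pow, mul_assoc] at h2
  rw [← h1, intervalIntegral.integral_const_mul] at h2
  have h3 : ∫ u in (0 : ℝ)..1, u ^ 2 * sphereInt G (r * u) = 1 / r * sphereFlux F r := by
    field_simp at h2 ⊢
    exact h2
  rw [h3]
  ring

theorem contDiff_rescale {φ : E3 → ℝ} (hφ : IsMollifier φ) (ε : ℝ) :
    ContDiff ℝ ∞ (rescale φ ε) :=
  contDiff_const.mul (hφ.smooth.comp (contDiff_const_smul _))

theorem hasCompactSupport_rescale {φ : E3 → ℝ} (hφ : IsMollifier φ) {ε : ℝ} (hε : 0 < ε) :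
    HasCompactSupport (rescale φ ε) :=
  (hφ.compact_support.comp_smul (inv_ne_zero hε.ne')).mul_left

/-- Mollified divergences converge to the value of the divergence at the origin. -/
theorem tendsto_integral_fderiv_rescale
    (hG : Continuous G)
    (H : ∀ φ : E3 → ℝ, ContDiff ℝ 1 φ → HasCompactSupport φ →
      ∑ i, ∫ l, fderiv ℝ φ l (basisVec i) * F i l = -∫ l, φ l * G l)
    {φ : E3 → ℝ} (hφ : IsMollifier φ) :
    Tendsto (fun ε => ∑ i, ∫ l, fderiv ℝ (rescale φ ε) l (basisVec i) * F i l) (𝓝[>] 0)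
      (𝓝 (-G 0)) := by
  have hc : Continuous fun ε : ℝ => -∫ u in tsupport φ, φ u * G (ε • u) := by
    refine (continuous_parametric_integral_of_continuous ?_ hφ.compact_support).neg
    have := hφ.smooth.continuous
    fun_prop
  have hfull : ∀ ε : ℝ, ∫ u in tsupport φ, φ u * G (ε • u) = ∫ u, φ u * G (ε • u) := fun ε =>
    setIntegral_eq_integral_of_forall_compl_eq_zero fun u hu => by
      rw [image_eq_zero_of_notMem_tsupport hu, zero_mul]
  have h0 : -∫ u in tsupport φ, φ u * G ((0 : ℝ) • u) = -G 0 := by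
    rw [hfull]
    simp [integral_mul_const, hφ.integral_eq_one]
  rw [← h0]
  refine ((hc.tendsto 0).mono_left nhdsWithin_le_nhds).congr' ?_
  filter_upwards [self_mem_nhdsWithin] with ε hε
  have hε : 0 < ε := hε
  rw [H _ ((contDiff_rescale hφ ε).of_le (by simp)) (hasCompactSupport_rescale hφ hε), hfull]
  have h1 := Measure.integral_comp_inv_smul (volume : Measure E3)
    (fun u => φ u * G (ε • u)) ε
  simp only [smul_inv_smul₀ hε.ne', finrank_euclideanSpace, Fintype.card_fin, smul_eq_mul] at h1
  rw [abs_of_pos (by positivity)] at h1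
  simp only [rescale, mul_assoc]
  rw [integral_const_mul, h1, inv_mul_cancel_left₀ (by positivity)]

end

section

variable {L : ℝ} [Fact (0 < L)]

/-! ### Averages of the increments -/

namespace TransportSol

variable {T p q m n : ℝ} {θ : ℝ × Torus L → ℝ} {v : Fin 3 → ℝ × Torus L → ℝ}
  {ψ : ℝ × Torus L → ℝ} {a b : ℝ}

/-- `flux` is the third-order structure function tested against `ψ`, for each single increment. -/
theorem flux_eq (D : TransportSol T p q m n θ v) (hψ : SmoothPer ψ)
    (hψs : TimeSupported a b ψ) (i : Fin 3) (h : ℝ × Torus L) :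
    flux θ v ψ i h = ∫ z, (v i (z + h) - v i z) * (θ (z + h) - θ z) ^ 2 * ψ z := by
  obtain ⟨K, hK⟩ := hψs.exists_bound hψ.continuous
  have I : ∀ h₁ h₂ h₃ : ℝ × Torus L,
      Integrable fun z => θ (z + h₁) * θ (z + h₂) * v i (z + h₃) * ψ z :=
    integrable_tri D.exponents D.mem_scalar D.mem_scalar (D.mem_velocity i)
      hψ.continuous.aestronglyMeasurable hK
  have i1 : Integrable fun z => ψ z * (θ (z + h) ^ 2 * v i (z + h)) :=
    (I h h h).congr (Eventually.of_forall fun z => by dsimp only; ring)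
  have i2 : Integrable fun z => 2 * (ψ z * θ z * (θ (z + h) * v i (z + h))) :=
    ((I 0 h h).const_mul 2).congr (Eventually.of_forall fun z => by
      dsimp only; rw [add_zero]; ring)
  have i3 : Integrable fun z => ψ z * θ z ^ 2 * v i (z + h) :=
    (I 0 0 h).congr (Eventually.of_forall fun z => by dsimp only; rw [add_zero]; ring)
  have i4 : Integrable fun z => ψ z * v i z * θ (z + h) ^ 2 :=
    (I h h 0).congr (Eventually.of_forall fun z => by dsimp only; rw [add_zero]; ring)
  have i5 : Integrable fun z => 2 * (ψ z * (θ z * v i z) * θ (z + h)) :=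
    ((I 0 h 0).const_mul 2).congr (Eventually.of_forall fun z => by
      dsimp only; rw [add_zero]; ring)
  have i6 : Integrable fun z => ψ z * (θ z ^ 2 * v i z) :=
    (I 0 0 0).congr (Eventually.of_forall fun z => by dsimp only; rw [add_zero]; ring)
  simp only [flux, corr]
  rw [← integral_const_mul, ← integral_const_mul, ← integral_sub i1 i2,
    ← integral_add (i1.fun_sub i2) i3, ← integral_sub ((i1.fun_sub i2).fun_add i3) i4,
    ← integral_add (((i1.fun_sub i2).fun_add i3).fun_sub i4) i5,
    ← integral_sub ((((i1.fun_sub i2).fun_add i3).fun_sub i4).fun_add i5) i6]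
  congr 1 with z
  ring

section Family

variable {Λ : Type*} [MeasurableSpace Λ] {μ : Measure Λ} [SFinite μ] {W : Fin 3 → Λ → ℝ}
  {Y : Λ → ℝ × Torus L}

/-- Joint absolute convergence of a superposition of `δv |δθ|²`. -/
theorem integrable_prod_increments (D : TransportSol T p q m n θ v)
    (hW : ∀ i, Integrable (W i) μ) (hY : Measurable Y) :
    Integrable (fun x : Λ × (ℝ × Torus L) => ∑ i, W i x.1 *
      ((v i (x.2 + Y x.1) - v i x.2) * (θ (x.2 + Y x.1) - θ x.2) ^ 2)) (μ.prod volume) := by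
  refine integrable_finsetSum _ fun i _ => ?_
  have I : ∀ {Y₁ Y₂ Y₃ : Λ → ℝ × Torus L}, Measurable Y₁ → Measurable Y₂ → Measurable Y₃ →
      Integrable (fun x : Λ × (ℝ × Torus L) => W i x.1 *
        (θ (x.2 + Y₁ x.1) * θ (x.2 + Y₂ x.1) * v i (x.2 + Y₃ x.1) * 1)) (μ.prod volume) :=
    fun h₁ h₂ h₃ => integrable_prod_tri D.exponents D.mem_scalar D.mem_scalar (D.mem_velocity i)
      (aestronglyMeasurable_const (b := (1 : ℝ))) (K := 1) (by simp) (hW i) h₁ h₂ h₃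
  have h0 : Measurable fun _ : Λ => (0 : ℝ × Torus L) := measurable_const
  have key := (((((I hY hY hY).fun_sub ((I h0 hY hY).const_mul 2)).fun_add (I h0 h0 hY)).fun_sub
    (I hY hY h0)).fun_add ((I h0 hY h0).const_mul 2)).fun_sub (I h0 h0 h0)
  refine key.congr (Eventually.of_forall fun x => ?_)
  simp only [add_zero]
  ring

/-- A superposition, with vector weights `W`, of the quantities `δv |δθ|²`. -/
def incrementAvg (μ : Measure Λ) (W : Fin 3 → Λ → ℝ) (Y : Λ → ℝ × Torus L)
    (θ : ℝ × Torus L → ℝ) (v : Fin 3 → ℝ × Torus L → ℝ) (z : ℝ × Torus L) : ℝ :=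
  ∫ l, ∑ i, W i l * ((v i (z + Y l) - v i z) * (θ (z + Y l) - θ z) ^ 2) ∂μ

theorem ae_integrable_increments (D : TransportSol T p q m n θ v)
    (hW : ∀ i, Integrable (W i) μ) (hY : Measurable Y) :
    ∀ᵐ z, Integrable (fun l => ∑ i, W i l *
      ((v i (z + Y l) - v i z) * (θ (z + Y l) - θ z) ^ 2)) μ :=
  (D.integrable_prod_increments hW hY).prod_left_ae

theorem integrable_incrementAvg (D : TransportSol T p q m n θ v)
    (hW : ∀ i, Integrable (W i) μ) (hY : Measurable Y) :
    Integrable (incrementAvg μ W Y θ v) :=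
  (D.integrable_prod_increments hW hY).integral_prod_right

/-- Testing a superposition of `δv |δθ|²` against `ψ` gives the superposition of `flux`. -/
theorem integral_incrementAvg_mul (D : TransportSol T p q m n θ v) (hψ : SmoothPer ψ)
    (hψs : TimeSupported a b ψ) (hW : ∀ i, Integrable (W i) μ) (hY : Measurable Y) :
    ∫ z, incrementAvg μ W Y θ v z * ψ z = ∫ l, ∑ i, W i l * flux θ v ψ i (Y l) ∂μ := by
  obtain ⟨K, hK⟩ := hψs.exists_bound hψ.continuous
  have h1 := (D.integrable_prod_increments hW hY).mul_bdd (c := K)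
    (hψ.continuous.aestronglyMeasurable.comp_snd (μ := μ))
    (Eventually.of_forall fun x => hK x.2)
  calc _ = ∫ z, ∫ l, (∑ i, W i l * ((v i (z + Y l) - v i z) * (θ (z + Y l) - θ z) ^ 2))
        * ψ z ∂μ := by
        simp_rw [incrementAvg, integral_mul_const]
    _ = ∫ l, ∫ z, (∑ i, W i l * ((v i (z + Y l) - v i z) * (θ (z + Y l) - θ z) ^ 2))
        * ψ z ∂volume ∂μ := (integral_integral_swap (f := fun l z =>
          (∑ i, W i l * ((v i (z + Y l) - v i z) * (θ (z + Y l) - θ z) ^ 2)) * ψ z) h1).symm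
    _ = _ := by
        congr 1 with l
        simp_rw [D.flux_eq hψ hψs, ← integral_const_mul]
        rw [← integral_finsetSum]
        · congr 1 with z
          rw [Finset.sum_mul]
          refine Finset.sum_congr rfl fun i _ => by ring
        · intro i _
          -- integrability for a single increment and a single component is the case of a point mass
          have h2 := D.integrable_prod_increments (μ := Measure.dirac ()) (Y := fun _ => Y l)
            (W := fun j _ => if j = i then W i l else 0) (fun j => by simp) measurable_const
          have h3 : ∀ᵐ u ∂(Measure.dirac ()), Integrable (fun z => ∑ j, (if j = i then W i l else 0)
            * ((v j (z + Y l) - v j z) * (θ (z + Y l) - θ z) ^ 2)) := h2.prod_right_ae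
          have h4 := h3.exists.choose_spec.mul_bdd (c := K) hψ.continuous.aestronglyMeasurable
            (Eventually.of_forall hK)
          refine h4.congr (Eventually.of_forall fun z => ?_)
          simp [ite_mul]
          ring

end Family

/-! ### The defect distribution -/

/-- The defect `∂ₜ(θ²/2) + div(v θ²/2)`, tested against `ψ`. -/
def defectFun (θ : ℝ × Torus L → ℝ) (v : Fin 3 → ℝ × Torus L → ℝ) (ψ : ℝ × Torus L → ℝ) : ℝ :=
  -∫ z, (θ z ^ 2 / 2 * dt ψ z + ∑ i, θ z ^ 2 / 2 * v i z * pd i ψ z)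

theorem integrable_sq_mul_dt (D : TransportSol T p q m n θ v) (hψ : SmoothPer ψ)
    (hψs : TimeSupported a b ψ) : Integrable fun z => θ z ^ 2 / 2 * dt ψ z := by
  obtain ⟨K, hK⟩ := hψs.dt.exists_bound hψ.continuous_dt
  exact (D.integrable_sq.div_const 2).mul_bdd hψ.continuous_dt.aestronglyMeasurable
    (Eventually.of_forall hK)

theorem integrable_sq_mul_pd (D : TransportSol T p q m n θ v) (hψ : SmoothPer ψ)
    (hψs : TimeSupported a b ψ) (i : Fin 3) :
    Integrable fun z => θ z ^ 2 / 2 * v i z * pd i ψ z := by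
  obtain ⟨K, hK⟩ := (hψs.pd i).exists_bound (hψ.continuous_pd i)
  have h := (D.integrable_sq_mul (D.mem_velocity i)).div_const 2
  refine (h.mul_bdd (hψ.continuous_pd i).aestronglyMeasurable
    (Eventually.of_forall hK)).congr (Eventually.of_forall fun z => ?_)
  dsimp only
  ring

/-- At increment zero, four times the defect: the three terms in `∂ᵢψ` combine to
`-2 ∫ θ² v · ∇ψ`, the last one is `-2 ∫ θ² ∂ₜψ`. -/
theorem fluxDiv_zero (D : TransportSol T p q m n θ v) (hψ : SmoothPer ψ)
    (hψs : TimeSupported a b ψ) : fluxDiv θ v ψ 0 = 4 * defectFun θ v ψ := by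
  have i1 := D.integrable_sq_mul_dt hψ hψs
  have i2 := D.integrable_sq_mul_pd hψ hψs
  rw [defectFun, integral_add i1 (integrable_finsetSum _ fun i _ => i2 i),
    integral_finsetSum _ fun i _ => i2 i]
  simp only [fluxDiv, corr, add_zero]
  have e1 : ∀ i, ∫ z, pd i ψ z * v i z * θ z ^ 2 = 2 * ∫ z, θ z ^ 2 / 2 * v i z * pd i ψ z :=
    fun i => by rw [← integral_const_mul]; congr 1 with z; ring
  have e2 : ∀ i, ∫ z, pd i ψ z * (θ z ^ 2 * v i z) = 2 * ∫ z, θ z ^ 2 / 2 * v i z * pd i ψ z :=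
    fun i => by rw [← integral_const_mul]; congr 1 with z; ring
  have e3 : ∀ i, ∫ z, pd i ψ z * (θ z * v i z) * θ z = 2 * ∫ z, θ z ^ 2 / 2 * v i z * pd i ψ z :=
    fun i => by rw [← integral_const_mul]; congr 1 with z; ring
  have e4 : ∫ z, dt ψ z * θ z * θ z = 2 * ∫ z, θ z ^ 2 / 2 * dt ψ z := by
    rw [← integral_const_mul]; congr 1 with z; ring
  simp_rw [e1, e2, e3, e4]
  simp only [sub_self, zero_sub, Finset.sum_neg_distrib, ← Finset.mul_sum]
  ring

omit [Fact (0 < L)] in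
theorem dt_add {f g : ℝ × Torus L → ℝ} (hf : SmoothPer f) (hg : SmoothPer g) (z : ℝ × Torus L) :
    dt (f + g) z = dt f z + dt g z :=
  ((hf.hasDerivAt_dt z).add (hg.hasDerivAt_dt z)).deriv

omit [Fact (0 < L)] in
theorem pd_add {f g : ℝ × Torus L → ℝ} (hf : SmoothPer f) (hg : SmoothPer g) (i : Fin 3)
    (z : ℝ × Torus L) : pd i (f + g) z = pd i f z + pd i g z :=
  ((hf.hasDerivAt_pd i z).add (hg.hasDerivAt_pd i z)).deriv

omit [Fact (0 < L)] in
theorem dt_smul {f : ℝ × Torus L → ℝ} (hf : SmoothPer f) (c : ℝ) (z : ℝ × Torus L) :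
    dt (c • f) z = c * dt f z :=
  ((hf.hasDerivAt_dt z).const_mul c).deriv

omit [Fact (0 < L)] in
theorem pd_smul {f : ℝ × Torus L → ℝ} (hf : SmoothPer f) (c : ℝ) (i : Fin 3)
    (z : ℝ × Torus L) : pd i (c • f) z = c * pd i f z :=
  ((hf.hasDerivAt_pd i z).const_mul c).deriv

theorem integrable_defect (D : TransportSol T p q m n θ v) (ψ : TestFn L T) :
    Integrable fun z => θ z ^ 2 / 2 * dt (ψ : ℝ × Torus L → ℝ) z
      + ∑ i, θ z ^ 2 / 2 * v i z * pd i (ψ : ℝ × Torus L → ℝ) z := by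
  obtain ⟨ψ, hψ, a, b, -, -, hψs⟩ := ψ
  exact (D.integrable_sq_mul_dt hψ hψs).add
    (integrable_finsetSum _ fun i _ => D.integrable_sq_mul_pd hψ hψs i)

/-- The defect `∂ₜ(θ²/2) + div(v θ²/2)`, as a linear functional on test functions. -/
def defect (D : TransportSol T p q m n θ v) : TestFn L T →ₗ[ℝ] ℝ where
  toFun ψ := defectFun θ v ψ
  map_add' ψ χ := by
    simp only [defectFun]
    rw [← neg_add, ← integral_add (D.integrable_defect ψ) (D.integrable_defect χ)]
    congr 2 with z
    rw [Submodule.coe_add, dt_add ψ.2.1 χ.2.1]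
    simp_rw [pd_add ψ.2.1 χ.2.1, mul_add, Finset.sum_add_distrib]
    ring
  map_smul' c ψ := by
    simp only [defectFun, RingHom.id_apply, smul_eq_mul]
    rw [mul_neg, ← integral_const_mul]
    congr 2 with z
    rw [Submodule.coe_smul, dt_smul ψ.2.1]
    simp_rw [pd_smul ψ.2.1, mul_add, Finset.mul_sum]
    congr 1
    · ring
    · exact Finset.sum_congr rfl fun i _ => by ring

/-- The defect has order one, as `θ²` and `θ² v` are integrable. -/
theorem isDistribution_defect (D : TransportSol T p q m n θ v) : IsDistribution D.defect := by
  intro a b _ _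
  refine ⟨1, (∫ z, ‖θ z ^ 2 / 2‖) + ∑ i, ∫ z, ‖θ z ^ 2 / 2 * v i z‖, fun ψ hψs M hM => ?_⟩
  have hψ : SmoothPer (ψ : ℝ × Torus L → ℝ) := ψ.2.1
  have hfd : ∀ z, ‖fderiv ℝ (lift (ψ : ℝ × Torus L → ℝ)) z‖ ≤ M := fun z => by
    rw [← norm_iteratedFDeriv_one]
    exact hM 1 le_rfl z
  have hM0 : 0 ≤ M := (norm_nonneg _).trans (hfd 0)
  have hdt : ∀ z, ‖dt (ψ : ℝ × Torus L → ℝ) z‖ ≤ M := by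
    rintro ⟨t, x⟩
    obtain ⟨l, rfl⟩ := proj_surjective x
    rw [hψ.dt_eq]
    refine (ContinuousLinearMap.le_of_opNorm_le _ (hfd _) _).trans ?_
    simp [Prod.norm_def]
  have hpd : ∀ i z, ‖pd i (ψ : ℝ × Torus L → ℝ) z‖ ≤ M := by
    rintro i ⟨t, x⟩
    obtain ⟨l, rfl⟩ := proj_surjective x
    rw [hψ.pd_eq]
    refine (ContinuousLinearMap.le_of_opNorm_le _ (hfd _) _).trans ?_
    simp [Prod.norm_def, basisVec]
  have j1 : Integrable fun z => θ z ^ 2 / 2 := D.integrable_sq.div_const 2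
  have j2 : ∀ i, Integrable fun z => θ z ^ 2 / 2 * v i z := fun i =>
    ((D.integrable_sq_mul (D.mem_velocity i)).div_const 2).congr
      (Eventually.of_forall fun z => by dsimp only; ring)
  change |defectFun θ v ψ| ≤ _
  rw [defectFun, abs_neg, ← Real.norm_eq_abs, add_mul, Finset.sum_mul, ← integral_mul_const]
  simp_rw [← integral_mul_const]
  have k1 := j1.norm.mul_const M
  have k2 := fun i => (j2 i).norm.mul_const M
  rw [← integral_finsetSum _ fun i _ => k2 i,
    ← integral_add k1 (integrable_finsetSum _ fun i _ => k2 i)]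
  refine norm_integral_le_of_norm_le (k1.add (integrable_finsetSum _ fun i _ => k2 i))
    (Eventually.of_forall fun z => ?_)
  refine (norm_add_le _ _).trans (add_le_add ?_ ((norm_sum_le _ _).trans ?_))
  · rw [norm_mul]
    exact mul_le_mul_of_nonneg_left (hdt z) (norm_nonneg _)
  · refine Finset.sum_le_sum fun i _ => ?_
    rw [norm_mul]
    exact mul_le_mul_of_nonneg_left (hpd i z) (norm_nonneg _)

/-! ### Limits of mollified and spherical averages -/

/-- The divergence identity for the restriction of `flux` to spatial increments. -/
theorem sum_integral_fderiv_mul_flux (D : TransportSol T p q m n θ v) (ψ : TestFn L T)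
    {φ : E3 → ℝ} (hφ : ContDiff ℝ 1 φ) (hφs : HasCompactSupport φ) :
    ∑ i, ∫ l, fderiv ℝ φ l (basisVec i) * flux θ v ψ i (inc L l)
      = -∫ l, φ l * fluxDiv θ v ψ (inc L l) := by
  obtain ⟨ψ, hψ, a, b, ha, hb, hψs⟩ := ψ
  have hδ : 0 < min a (T - b) / 2 := half_pos (lt_min ha (by linarith))
  have h1 := min_le_left a (T - b)
  have h2 := min_le_right a (T - b)
  exact sum_integral_fderiv_mul_of_kernel hδ (fun i => D.continuous_flux hψ hψs i)
    (D.continuous_fluxDiv hψ hψs)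
    (fun η hη hηs => sum_integral_pd_mul_flux ha hb hψ hψs hη hηs (by linarith) (by linarith) D)
    hφ hφs

theorem continuous_flux_inc (D : TransportSol T p q m n θ v) (ψ : TestFn L T) (i : Fin 3) :
    Continuous fun l => flux θ v ψ i (inc L l) := by
  obtain ⟨ψ, hψ, a, b, ha, hb, hψs⟩ := ψ
  exact (D.continuous_flux hψ hψs i).comp continuous_inc

theorem continuous_fluxDiv_inc (D : TransportSol T p q m n θ v) (ψ : TestFn L T) :
    Continuous fun l => fluxDiv θ v ψ (inc L l) := by
  obtain ⟨ψ, hψ, a, b, ha, hb, hψs⟩ := ψ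
  exact (D.continuous_fluxDiv hψ hψs).comp continuous_inc

theorem fluxDiv_inc_zero (D : TransportSol T p q m n θ v) (ψ : TestFn L T) :
    fluxDiv θ v ψ (inc L 0) = 4 * D.defect ψ := by
  obtain ⟨ψ, hψ, a, b, ha, hb, hψs⟩ := ψ
  have : inc L 0 = 0 := by simp [inc]
  rw [this]
  exact D.fluxDiv_zero hψ hψs

/-- The mollified divergence of `flux` tends to `-fluxDiv 0`, whatever the mollifier. -/
theorem tendsto_mollified (D : TransportSol T p q m n θ v) (ψ : TestFn L T) {φ : E3 → ℝ}
    (hφ : IsMollifier φ) :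
    Tendsto (fun ε => -(1 / 4) * ∑ i, ∫ l, fderiv ℝ (rescale φ ε) l (basisVec i)
      * flux θ v ψ i (inc L l)) (𝓝[>] 0) (𝓝 (D.defect ψ)) := by
  have h := tendsto_integral_fderiv_rescale (F := fun i l => flux θ v ψ i (inc L l))
    (D.continuous_fluxDiv_inc ψ) (fun φ hφ hφs => D.sum_integral_fderiv_mul_flux ψ hφ hφs) hφ
  have h2 := h.const_mul (-(1 / 4))
  rw [D.fluxDiv_inc_zero] at h2
  convert h2 using 2
  ring

/-- The spherical averages of `flux` tend to `fluxDiv 0 / 3`. -/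
theorem tendsto_spherical (D : TransportSol T p q m n θ v) (ψ : TestFn L T) :
    Tendsto (fun r => 1 / r * (1 / (4 * Real.pi) *
      sphereFlux (fun i l => flux θ v ψ i (inc L l)) r)) (𝓝[>] 0) (𝓝 (4 / 3 * D.defect ψ)) := by
  have h := tendsto_sphereFlux (D.continuous_flux_inc ψ)
    (D.continuous_fluxDiv_inc ψ) (fun φ hφ hφs => D.sum_integral_fderiv_mul_flux ψ hφ hφs)
  rw [D.fluxDiv_inc_zero] at h
  convert h using 2
  ring

end TransportSol

/-! ### Extension by zero of a solution on the slab -/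

/-- `MemLpLq`, phrased with `eLpNorm` on time slices, gives `MemMixed` for the extension by zero.
It is applied to components and norms, whence the function `g` dominated by `f`. -/
theorem memMixed_indicator_of_memLpLq {F : Type*} [NormedAddCommGroup F] {T p q : ℝ} (hp : 0 < p)
    (hq : 0 < q) {f : ℝ × Torus L → F}
    (hf : MemLpLq T (ENNReal.ofReal p) (ENNReal.ofReal q) f) {g : ℝ × Torus L → ℝ}
    (hg : AEStronglyMeasurable g (volume.restrict (slab L T))) (hgf : ∀ z, ‖g z‖ ≤ ‖f z‖) :
    MemMixed p q ((slab L T).indicator g) := by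
  refine ⟨(aestronglyMeasurable_indicator_iff (measurableSet_slab T)).2 hg, ?_⟩
  rw [mixedNorm_indicator_slab hp hq]
  have h1 := hf.memLp_norm.2
  have hp0 : ENNReal.ofReal p ≠ 0 := by simpa using hp
  have hq0 : ENNReal.ofReal q ≠ 0 := by simpa using hq
  rw [eLpNorm_eq_lintegral_rpow_enorm_toReal hp0 ENNReal.ofReal_ne_top,
    ENNReal.toReal_ofReal hp.le] at h1
  refine lt_of_le_of_lt ?_ h1
  refine ENNReal.rpow_le_rpow (lintegral_mono_ae ?_) (by positivity)
  filter_upwards [hf.ae_memLp] with t ht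
  refine ENNReal.rpow_le_rpow ?_ hp.le
  rw [Real.enorm_eq_ofReal ENNReal.toReal_nonneg, ENNReal.ofReal_toReal ht.2.ne,
    eLpNorm_eq_lintegral_rpow_enorm_toReal hq0 ENNReal.ofReal_ne_top,
    ENNReal.toReal_ofReal hq.le]
  gcongr with x
  exact enorm_le_iff_norm_le.2 (hgf _)

/-- The extension of the scalar by zero. -/
def extScalar (T : ℝ) (θ : ℝ × Torus L → ℝ) : ℝ × Torus L → ℝ := (slab L T).indicator θ

/-- The extension by zero of the components of the velocity. -/
def extVelocity (T : ℝ) (v : ℝ × Torus L → E3) (i : Fin 3) : ℝ × Torus L → ℝ :=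
  (slab L T).indicator fun z => v z i

/-- A weak solution, extended by zero, is a `TransportSol`. -/
theorem transportSol_ext {T p q m n : ℝ} {v : ℝ × Torus L → E3} {θ : ℝ × Torus L → ℝ}
    (e : HolderExponents p q m n) (hsol : IsWeakSolution T v θ)
    (hθ : MemLpLq T (ENNReal.ofReal p) (ENNReal.ofReal q) θ)
    (hv : MemLpLq T (ENNReal.ofReal m) (ENNReal.ofReal n) v) :
    TransportSol T p q m n (extScalar T θ) (extVelocity T v) where
  exponents := e
  mem_scalar := memMixed_indicator_of_memLpLq e.hp e.hq hθ hθ.1 fun _ => le_rfl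
  mem_velocity i := memMixed_indicator_of_memLpLq e.hm e.hn hv
    ((continuous_coord i).comp_aestronglyMeasurable hv.1) fun z => PiLp.norm_apply_le _ i
  scalar_off z hz := indicator_of_notMem hz _
  velocity_off i z hz := indicator_of_notMem hz _
  transport ψ hψ := by
    rw [← hsol.transport ψ hψ, ← integral_indicator (measurableSet_slab T)]
    congr 1 with z
    by_cases hz : z ∈ slab L T
    · simp only [extScalar, extVelocity, indicator_of_mem hz]
      rw [SmoothPer.inner_gradx hψ.1]
      simp
    · simp [extScalar, extVelocity, indicator_of_notMem hz]
  div_free ψ hψ := by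
    rw [← hsol.div_free ψ hψ, ← integral_indicator (measurableSet_slab T)]
    congr 1 with z
    by_cases hz : z ∈ slab L T
    · simp only [extVelocity, indicator_of_mem hz]
      rw [SmoothPer.inner_gradx hψ.1]
    · simp [extVelocity, indicator_of_notMem hz]

omit [Fact (0 < L)] in
/-- A spatial increment does not leave the slab, so the extension by zero does not affect
`δv |δθ|²` there. -/
theorem increments_ext {T : ℝ} (v : ℝ × Torus L → E3) (θ : ℝ × Torus L → ℝ) {z : ℝ × Torus L}
    (hz : z ∈ slab L T) (l : E3) (w : E3) :
    inner ℝ w (incr v l z) * |incr θ l z| ^ 2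
      = ∑ i, w i * ((extVelocity T v i (z + inc L l) - extVelocity T v i z)
        * (extScalar T θ (z + inc L l) - extScalar T θ z) ^ 2) := by
  have hz' : z + inc L l ∈ slab L T := ⟨by simpa [inc] using hz.1, mem_univ _⟩
  have e : (z.1, z.2 + proj L l) = z + inc L l := by ext <;> simp [inc]
  simp only [extScalar, extVelocity, indicator_of_mem hz, indicator_of_mem hz', incr, e]
  rw [inner_eq_sum, sq_abs, Finset.sum_mul]
  refine Finset.sum_congr rfl fun i _ => ?_
  simp
  ring

theorem gradient_apply (f : E3 → ℝ) (l : E3) (i : Fin 3) :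
    gradient f l i = fderiv ℝ f l (basisVec i) := by
  have h : ∀ u : E3, u i = inner ℝ u (basisVec i) := fun u => by
    simp [basisVec, EuclideanSpace.inner_single_right]
  rw [h, gradient, InnerProductSpace.toDual_symm_apply]

theorem locL1_of_integrable {F : Type*} [NormedAddCommGroup F] {T : ℝ} {f g : ℝ × Torus L → F}
    (hg : Integrable g) (h : ∀ z ∈ slab L T, f z = g z) : LocL1 T f :=
  IntegrableOn.locallyIntegrableOn
    (hg.integrableOn.congr_fun (fun z hz => (h z hz).symm) (measurableSet_slab T))

theorem setIntegral_slab_mul {T : ℝ} {f g : ℝ × Torus L → ℝ} (ψ : TestFn L T)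
    (h : ∀ z ∈ slab L T, f z = g z) :
    ∫ z in slab L T, f z * (ψ : ℝ × Torus L → ℝ) z = ∫ z, g z * (ψ : ℝ × Torus L → ℝ) z := by
  obtain ⟨ψ, hψ, a, b, ha, hb, hψs⟩ := ψ
  rw [← integral_indicator (measurableSet_slab T)]
  congr 1 with z
  by_cases hz : z ∈ slab L T
  · simp [indicator_of_mem hz, h z hz]
  · have : ψ z = 0 := hψs z.1 z.2 fun hz' =>
      hz ⟨⟨ha.trans_le hz'.1, hz'.2.trans_lt hb⟩, mem_univ _⟩
    simp [indicator_of_notMem hz, this]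

end

end

end Yaglom

theorem theorem1p1 (L : ℝ) [Fact (0 < L)] (T : ℝ) (hT : 0 < T)
    (p q m n : ℝ) (hp : 1 < p) (hq : 1 < q) (hm : 1 < m) (hn : 1 < n)
    (hpm : 2 / p + 1 / m = 1) (hqn : 2 / q + 1 / n = 1)
    (v : ℝ × Torus L → E3) (θ : ℝ × Torus L → ℝ)
    (hsol : IsWeakSolution T v θ)
    (hθ₂ : MemLpLq T ∞ 2 θ)
    (hθ : MemLpLq T (ENNReal.ofReal p) (ENNReal.ofReal q) θ)
    (hv : MemLpLq T (ENNReal.ofReal m) (ENNReal.ofReal n) v) :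
    ∃ D S : TestFn L T →ₗ[ℝ] ℝ, IsDistribution D ∧ IsDistribution S ∧
      -- the Duchon–Robert terms are well defined and converge to the same limit `D`
      -- for every mollifier
      (∀ φ : E3 → ℝ, IsMollifier φ →
        (∀ ε > 0, ∀ᵐ z ∂(MeasureTheory.volume.restrict (slab L T)),
          MeasureTheory.Integrable (drIntegrand φ v θ ε z)) ∧
        TendstoDistrib (duchonRobert φ v θ) D) ∧
      -- the local energy balance
      LocalEnergyBalance v θ D ∧
      -- the structure functions are well defined, and `S` is minus their limit
      (∀ r > 0, ∀ᵐ z ∂(MeasureTheory.volume.restrict (slab L T)),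
        MeasureTheory.Integrable (sphereIntegrand v θ r z) surfaceMeasure) ∧
      TendstoDistrib (fun r z => -structureFn v θ r z) S ∧
      -- the 4/3 law
      S = (-(4 / 3 : ℝ)) • D := by
  have e : HolderExponents p q m n := ⟨by linarith, by linarith, by linarith, by linarith, hpm, hqn⟩
  have D := transportSol_ext e hsol hθ hv
  set θ₀ := extScalar T θ
  set v₀ := extVelocity T v
  have hDdist := D.isDistribution_defect
  refine ⟨D.defect, (-(4 / 3 : ℝ)) • D.defect, hDdist, ?_, ?_, ?_, ?_, ?_, rfl⟩
  · intro a b ha hb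
    obtain ⟨N, C, hC⟩ := hDdist a b ha hb
    refine ⟨N, 4 / 3 * C, fun ψ hψ M hM => ?_⟩
    have h1 := hC ψ hψ M hM
    rw [LinearMap.smul_apply, smul_eq_mul, abs_mul, abs_neg, abs_of_pos (by norm_num)]
    linarith
  · intro φ hφ
    have hW : ∀ ε > 0, ∀ i, Integrable fun l => fderiv ℝ (rescale φ ε) l (basisVec i) :=
      fun ε hε i => (((contDiff_rescale hφ ε).continuous_fderiv (by simp)).clm_apply
        continuous_const).integrable_of_hasCompactSupport
        ((hasCompactSupport_rescale hφ hε).fderiv_apply (𝕜 := ℝ) _)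
    have hY : Measurable (inc L) := continuous_inc.measurable
    have hdr : ∀ ε, ∀ z ∈ slab L T, ∀ l, drIntegrand φ v θ ε z l =
        ∑ i, fderiv ℝ (rescale φ ε) l (basisVec i) *
          ((v₀ i (z + inc L l) - v₀ i z) * (θ₀ (z + inc L l) - θ₀ z) ^ 2) := by
      intro ε z hz l
      rw [drIntegrand, increments_ext v θ hz]
      simp_rw [gradient_apply]
      rfl
    have hDR : ∀ ε, ∀ z ∈ slab L T, duchonRobert φ v θ ε z = -(1 / 4) *
        TransportSol.incrementAvg volume
          (fun i l => fderiv ℝ (rescale φ ε) l (basisVec i)) (inc L) θ₀ v₀ z := by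
      intro ε z hz
      rw [duchonRobert, TransportSol.incrementAvg]
      simp_rw [hdr ε z hz]
    refine ⟨fun ε hε => ?_, fun ε hε => ?_, fun ψ => ?_⟩
    · filter_upwards [ae_restrict_of_ae (D.ae_integrable_increments (hW ε hε) hY),
        ae_restrict_mem (measurableSet_slab T)] with z hz hzs
      exact hz.congr (Eventually.of_forall fun l => (hdr ε z hzs l).symm)
    · exact locL1_of_integrable
        ((D.integrable_incrementAvg (hW ε hε) hY).const_mul (-(1 / 4))) (hDR ε)
    · refine (D.tendsto_mollified ψ hφ).congr' ?_
      filter_upwards [self_mem_nhdsWithin] with ε hε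
      rw [setIntegral_slab_mul ψ (hDR ε)]
      have hψ := ψ.2
      obtain ⟨hψ, a, b, ha, hb, hψs⟩ := hψ
      simp_rw [mul_assoc (-(1 / 4) : ℝ)]
      rw [integral_const_mul, D.integral_incrementAvg_mul hψ hψs (hW ε hε) hY,
        integral_finsetSum]
      intro i _
      exact ((((contDiff_rescale hφ ε).continuous_fderiv (by simp)).clm_apply
        continuous_const).mul (D.continuous_flux_inc ψ i)).integrable_of_hasCompactSupport
        ((hasCompactSupport_rescale hφ hε).fderiv_apply (𝕜 := ℝ) _).mul_right
  · have hvn : MemMixed m n ((slab L T).indicator fun z => ‖v z‖) :=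
      memMixed_indicator_of_memLpLq e.hm e.hn hv hv.1.norm fun z => by simp
    refine ⟨?_, ?_, fun ψ => ?_⟩
    · refine locL1_of_integrable (D.integrable_sq.div_const 2) fun z hz => ?_
      simp [θ₀, extScalar, indicator_of_mem hz]
    · refine IntegrableOn.locallyIntegrableOn ?_
      refine Integrable.mono' ((D.integrable_sq_mul hvn).div_const 2).integrableOn
        (((by fun_prop : Continuous fun x : ℝ => x ^ 2 / 2).comp_aestronglyMeasurable hθ.1).smul
          hv.1) ?_
      filter_upwards [ae_restrict_mem (measurableSet_slab T)] with z hz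
      simp only [θ₀, extScalar, indicator_of_mem hz, norm_smul]
      rw [Real.norm_of_nonneg (by positivity)]
      exact le_of_eq (by ring)
    · change _ = TransportSol.defectFun θ₀ v₀ ψ
      rw [TransportSol.defectFun, ← integral_indicator (measurableSet_slab T)]
      congr 2 with z
      by_cases hz : z ∈ slab L T
      · simp only [θ₀, v₀, extScalar, extVelocity, indicator_of_mem hz]
        rw [SmoothPer.inner_gradx ψ.2.1]
        simp
      · simp [θ₀, v₀, extScalar, extVelocity, indicator_of_notMem hz]
  all_goals
    have hW : ∀ i, Integrable (fun ζ : Metric.sphere (0 : E3) 1 => (ζ : E3) i) surfaceMeasure :=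
      fun i => ((continuous_coord i).comp continuous_subtype_val).integrable_of_hasCompactSupport
        (HasCompactSupport.of_compactSpace _)
    have hYc : ∀ r : ℝ, Continuous fun ζ : Metric.sphere (0 : E3) 1 => inc L (r • (ζ : E3)) :=
      fun r => continuous_inc.comp (by fun_prop)
    have hsp : ∀ r : ℝ, ∀ z ∈ slab L T, ∀ ζ, sphereIntegrand v θ r z ζ = ∑ i, (ζ : E3) i *
        ((v₀ i (z + inc L (r • (ζ : E3))) - v₀ i z)
          * (θ₀ (z + inc L (r • (ζ : E3))) - θ₀ z) ^ 2) := fun r z hz ζ => by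
      rw [sphereIntegrand, increments_ext v θ hz]
  · intro r _
    filter_upwards [ae_restrict_of_ae (D.ae_integrable_increments hW (hYc r).measurable),
      ae_restrict_mem (measurableSet_slab T)] with z hz hzs
    exact hz.congr (Eventually.of_forall fun ζ => (hsp r z hzs ζ).symm)
  · have hS : ∀ r : ℝ, ∀ z ∈ slab L T, -structureFn v θ r z = -(1 / r * (1 / (4 * Real.pi))) *
        TransportSol.incrementAvg surfaceMeasure (fun i ζ => (ζ : E3) i)
          (fun ζ => inc L (r • (ζ : E3))) θ₀ v₀ z := by
      intro r z hz
      rw [structureFn, TransportSol.incrementAvg]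
      simp_rw [hsp r z hz]
      ring
    refine ⟨fun r _ => ?_, fun ψ => ?_⟩
    · exact locL1_of_integrable
        ((D.integrable_incrementAvg hW (hYc r).measurable).const_mul _) (hS r)
    · have h := (D.tendsto_spherical ψ).neg
      rw [LinearMap.smul_apply, smul_eq_mul, neg_mul]
      refine h.congr fun r => ?_
      rw [setIntegral_slab_mul ψ (hS r)]
      have hψ := ψ.2
      obtain ⟨hψ, a, b, ha, hb, hψs⟩ := hψ
      simp_rw [mul_assoc (-(1 / r * (1 / (4 * Real.pi))))]
      rw [integral_const_mul, D.integral_incrementAvg_mul hψ hψs hW (hYc r).measurable, sphereFlux]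
      ring
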